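/- **Proposition 4.1.** There is a universal constant $C>0$ such that the following holds. Let $N \ge 3$ and $1 \le n \le N$ be integers, let $v \in \mathbb{R}^N$ be a fixed vector, and let $b_1,\dots,b_N$ be i.i.d. random vectors with distribution $\mathcal{N}\big(0,\tfrac1N I_{n-1}\big)$. For $i = 1,\dots,N$ let $y_i \in \mathbb{R}^n$ be defined by $y_i^\top = (v_i \;\; b_i^\top)$, and define the $n \times n$ matrix $$M = \sum_{i=1}^N \Big( \|y_i\|^2 - \frac{n-1}{N} \Big) y_i y_i^\top - \frac{3}{N} I_n .$$ For $\delta \in (0,1)$ let $$\begin{aligned}\eta := C \bigg( &(\|v\|+1)\,\frac{n\sqrt{\log(N/\delta)}}{N^{3/2}} + \|v\|_4^2\, \frac{\sqrt{n\log(N/\delta)}}{N} + \|v\|_6^3\, \frac{\sqrt n + \sqrt{\log(N/\delta)}}{\sqrt N} \\ &+ \|v\|_\infty^2\, \frac{n\log(N/\delta) + \log^2(N/\delta)}{N} + \frac{(n\log(N/\delta))^{3/2}}{N^2} + \frac1N \big|\|v\|^2-1\big| \bigg).\end{aligned}$$ Suppose that $N \ge \log^7(N/\delta)$. Then, with probability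 at least $1-\delta$, $$\Big\| M - \Big(\|v\|_4^4 - \frac3N\Big) e_1 e_1^\top \Big\| \le \eta ,$$ where $e_1$ is the first standard basis vector of $\mathbb{R}^n$. Here $\|\cdot\|$ is the Euclidean norm of a vector and the spectral norm of a matrix, and $\|\cdot\|_p$ is the $\ell_p$ norm of a vector. -/

import Mathlib

open MeasureTheory ProbabilityTheory
open scoped ENNReal Matrix Matrix.Norms.L2Operator

/-- The `ℓ_p` norm of a vector `v ∈ ℝ^N`, for `p ∈ [1, ∞]`. -/
noncomputable def vecNorm {N : ℕ} (p : ℝ≥0∞) (v : Fin N → ℝ) : ℝ :=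
  ‖WithLp.toLp p v‖

/-- The vector `y = (x, bᵀ)ᵀ ∈ ℝ^(m+1)` obtained by putting the entry `x` in front of `b ∈ ℝ^m`. -/
noncomputable def plantedRow {m : ℕ} (x : ℝ) (b : EuclideanSpace ℝ (Fin m)) :
    EuclideanSpace ℝ (Fin (m + 1)) :=
  WithLp.toLp 2 (Fin.cons x b.ofLp)

/-- The `n × n` matrix `∑ i, (‖y i‖² - (n-1)/N) (y i) (y i)ᵀ - (3/N) I_n`. -/
noncomputable def fourthMomentMatrix {n N : ℕ} (y : Fin N → EuclideanSpace ℝ (Fin n)) :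
    Matrix (Fin n) (Fin n) ℝ :=
  (∑ i, (‖y i‖ ^ 2 - ((n : ℝ) - 1) / N) • Matrix.vecMulVec (y i).ofLp (y i).ofLp)
    - (3 / (N : ℝ)) • (1 : Matrix (Fin n) (Fin n) ℝ)

/-- The matrix `e₁ e₁ᵀ`, where `e₁` is the first standard basis vector of `ℝ^(m+1)`. -/
noncomputable def firstProj (m : ℕ) : Matrix (Fin (m + 1)) (Fin (m + 1)) ℝ :=
  Matrix.vecMulVec (Pi.single 0 1) (Pi.single 0 1)

/-- The error bound `η(N, n, v, δ)` with the universal constant `C`. -/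
noncomputable def etaBound (C : ℝ) (N n : ℕ) (v : Fin N → ℝ) (δ : ℝ) : ℝ :=
  C * ((vecNorm 2 v + 1) * ((n : ℝ) * √(Real.log (N / δ)) / (N : ℝ) ^ (3 / 2 : ℝ))
    + vecNorm 4 v ^ 2 * (√((n : ℝ) * Real.log (N / δ)) / N)
    + vecNorm 6 v ^ 3 * ((√(n : ℝ) + √(Real.log (N / δ))) / √(N : ℝ))
    + vecNorm ∞ v ^ 2 * (((n : ℝ) * Real.log (N / δ) + Real.log (N / δ) ^ 2) / N)
    + ((n : ℝ) * Real.log (N / δ)) ^ (3 / 2 : ℝ) / (N : ℝ) ^ 2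
    + 1 / (N : ℝ) * |vecNorm 2 v ^ 2 - 1|)

/-! Put n = m + 1, L = log(N/δ) and g_i = √N b_i, so that the g_i are independent standard Gaussian
vectors, and let W_i = ‖g_i‖² - m. The weight of y_i y_iᵀ is then v_i² + W_i/N. Splitting the test
vectors into first coordinate and tail (`dotProduct_fourthMomentMatrix_sub`) turns the bilinear form
of the matrix into a handful of sums: ∑ v_i² W_i on the corner; the linear forms with weights v_i³
and v_i W_i off the diagonal; and the Gram forms with weights v_i² and W_i on the tail block. The
corner loses its mean ‖v‖_4⁴. The Gram forms have means ‖v‖² and 2N times the identity, so after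
scaling and subtracting 3/N the tail block keeps (‖v‖² - 1)/N, the last term of η.

Each sum is controlled by Bernstein's inequality for a fixed direction
(`SubGamma.measure_abs_sum_gt_le`) at deviation level 4(m + L), which pays for a union bound over a
1/2-net of the unit ball or over pairs of its points; the scalar sum needs only level 4L.

The obstacle is that W times one or two linear factors has tails too heavy for Bernstein. Therefore
W is truncated at a level K of order √(nL) + L, which with high probability changes none of the W_i.
The truncated product is sub-gamma with range of order K, but with variance proxy of order n instead
of K², because only the fourth moment of W enters (`subGamma_mul_sub_integral`). Truncation biases
the W-weighted Gram form, and Cauchy–Schwarz-type splitting makes the bias small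
(`abs_integral_truncDev_mul_inner_mul_inner_sub_le`).

For the linear form with weights v_i W_i one tail bound is not enough: the Bernstein bound serves L
≥ n, and a purely sub-Gaussian bound with proxy K² serves n ≥ L (`min_cross_term_le`). Elementary
inequalities in √n, √L, √N then compare everything with η; the assumption on N enters as L³ ≤ N. -/

/-! ### Sub-gamma variables, Chernoff and Bernstein bounds -/

/-- A random variable whose moment generating function is at most `exp (s² V)` for `|s| R ≤ 1`. -/
structure SubGamma {Ω : Type*} [MeasurableSpace Ω] (X : Ω → ℝ) (μ : Measure Ω) (V R : ℝ) :
    Prop where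
  aemeasurable : AEMeasurable X μ
  integrable : ∀ s : ℝ, |s| * R ≤ 1 → Integrable (fun ω => Real.exp (s * X ω)) μ
  mgf_le : ∀ s : ℝ, |s| * R ≤ 1 → mgf X μ s ≤ Real.exp (s ^ 2 * V)

theorem SubGamma.mono {Ω : Type*} [MeasurableSpace Ω] {X : Ω → ℝ} {μ : Measure Ω} {V V' R R' : ℝ}
    (h : SubGamma X μ V R) (hV : V ≤ V') (hR : R ≤ R') : SubGamma X μ V' R' where
  aemeasurable := h.aemeasurable
  integrable s hs := h.integrable s (le_trans (by gcongr) hs)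
  mgf_le s hs := (h.mgf_le s (le_trans (by gcongr) hs)).trans (by gcongr)

theorem SubGamma.neg {Ω : Type*} [MeasurableSpace Ω] {X : Ω → ℝ} {μ : Measure Ω} {V R : ℝ}
    (h : SubGamma X μ V R) : SubGamma (-X) μ V R where
  aemeasurable := h.aemeasurable.neg
  integrable s hs := by simpa using h.integrable (-s) (by simpa using hs)
  mgf_le s hs := by
    rw [mgf_neg]
    simpa using h.mgf_le (-s) (by simpa using hs)

/-- The choice is s = min(√(τ/V), 1/R): the unconstrained value in the sub-Gaussian range, and the
end of the admissible interval beyond it. -/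
theorem exists_chernoff_parameter {V R τ : ℝ} (hV : 0 < V) (hR : 0 ≤ R) (hτ : 0 ≤ τ) :
    ∃ s : ℝ, 0 ≤ s ∧ s * R ≤ 1 ∧ τ ≤ s * (2 * (√V * √τ + R * τ)) - s ^ 2 * V := by
  obtain ⟨a, ha, rfl⟩ : ∃ a : ℝ, 0 < a ∧ V = a ^ 2 :=
    ⟨√V, Real.sqrt_pos.2 hV, (Real.sq_sqrt hV.le).symm⟩
  obtain ⟨t, ht, rfl⟩ : ∃ t : ℝ, 0 ≤ t ∧ τ = t ^ 2 :=
    ⟨√τ, Real.sqrt_nonneg _, (Real.sq_sqrt hτ).symm⟩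
  rw [Real.sqrt_sq ha.le, Real.sqrt_sq ht]
  by_cases hc : R * t ≤ a
  · refine ⟨t / a, by positivity, ?_, ?_⟩
    · rw [div_mul_eq_mul_div, div_le_one ha]; linarith
    · have : t / a * (2 * (a * t + R * t ^ 2)) - (t / a) ^ 2 * a ^ 2
          = t ^ 2 + 2 * R * t ^ 3 / a := by field_simp; ring
      rw [this]
      have : 0 ≤ 2 * R * t ^ 3 / a := by positivity
      linarith
  · push Not at hc
    have hRp : 0 < R := by
      rcases hR.lt_or_eq with h | h
      · exact h
      · rw [← h] at hc; linarith
    refine ⟨1 / R, by positivity, by rw [one_div_mul_cancel hRp.ne'], ?_⟩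
    have : 1 / R * (2 * (a * t + R * t ^ 2)) - (1 / R) ^ 2 * a ^ 2
          = t ^ 2 + (t ^ 2 + a / R * (2 * t - a / R)) := by field_simp; ring
    rw [this]
    have h1 : a / R ≤ t := by rw [div_le_iff₀ hRp]; linarith
    have : 0 ≤ a / R * (2 * t - a / R) := mul_nonneg (by positivity) (by linarith)
    nlinarith

theorem SubGamma.measure_abs_gt_le {Ω : Type*} [MeasurableSpace Ω] {X : Ω → ℝ} {μ : Measure Ω}
    [IsFiniteMeasure μ] {V R τ : ℝ} (h : SubGamma X μ V R) (hV : 0 < V) (hR : 0 ≤ R)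
    (hτ : 0 ≤ τ) :
    μ {ω | 2 * (√V * √τ + R * τ) < |X ω|} ≤ ENNReal.ofReal (2 * Real.exp (-τ)) := by
  obtain ⟨s, hs0, hsR, hs⟩ := exists_chernoff_parameter hV hR hτ
  set t := 2 * (√V * √τ + R * τ)
  have key : ∀ Y : Ω → ℝ, SubGamma Y μ V R →
      μ {ω | t ≤ Y ω} ≤ ENNReal.ofReal (Real.exp (-τ)) := by
    intro Y hY
    have hs' : |s| * R ≤ 1 := by rwa [abs_of_nonneg hs0]
    have h1 := measure_ge_le_exp_mul_mgf t hs0 (hY.integrable s hs')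
    have h2 : Real.exp (-s * t) * mgf Y μ s ≤ Real.exp (-τ) := by
      calc _ ≤ Real.exp (-s * t) * Real.exp (s ^ 2 * V) := by gcongr; exact hY.mgf_le s hs'
        _ = Real.exp (-s * t + s ^ 2 * V) := (Real.exp_add _ _).symm
        _ ≤ _ := Real.exp_le_exp.2 (by linarith)
    rw [← ofReal_measureReal (measure_ne_top _ _)]
    exact ENNReal.ofReal_le_ofReal (h1.trans h2)
  calc μ {ω | t < |X ω|} ≤ μ ({ω | t ≤ X ω} ∪ {ω | t ≤ (-X) ω}) := by
        refine measure_mono fun ω hω => ?_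
        rcases lt_abs.1 (show t < |X ω| from hω) with h | h
        · exact Or.inl h.le
        · exact Or.inr h.le
    _ ≤ _ := measure_union_le _ _
    _ ≤ ENNReal.ofReal (Real.exp (-τ)) + ENNReal.ofReal (Real.exp (-τ)) :=
        add_le_add (key X h) (key _ h.neg)
    _ = _ := by rw [← ENNReal.ofReal_add (by positivity) (by positivity)]; ring_nf

theorem SubGamma.comp_hasLaw {Ω E : Type*} [MeasurableSpace Ω] [MeasurableSpace E] {φ : E → ℝ}
    {ν : Measure E} {μ : Measure Ω} {V R : ℝ} (h : SubGamma φ ν V R) {Y : Ω → E}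
    (hY : HasLaw Y ν μ) : SubGamma (fun ω => φ (Y ω)) μ V R := by
  have hν : ν = μ.map Y := hY.map_eq.symm
  have hφ : AEMeasurable φ (μ.map Y) := hν ▸ h.aemeasurable
  refine ⟨hφ.comp_aemeasurable hY.aemeasurable, fun s hs => ?_, fun s hs => ?_⟩
  · have := h.integrable s hs
    rw [hν] at this
    exact this.comp_aemeasurable hY.aemeasurable
  · have := h.mgf_le s hs
    rw [hν, mgf_map hY.aemeasurable
      ((hφ.const_mul s).exp.aestronglyMeasurable)] at this
    exact this

theorem SubGamma.sum_mul {Ω ι : Type*} [MeasurableSpace Ω] [Fintype ι] {X : ι → Ω → ℝ}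
    {μ : Measure Ω} [IsProbabilityMeasure μ] {V R : ℝ} (hR : 0 ≤ R) (hX : ∀ i, SubGamma (X i) μ V R)
    (hind : iIndepFun X μ) {c : ι → ℝ} {d : ℝ} (hd : ∀ i, |c i| ≤ d) :
    SubGamma (fun ω => ∑ i, c i * X i ω) μ (V * ∑ i, c i ^ 2) (R * d) := by
  have hi : iIndepFun (fun i ω => c i * X i ω) μ :=
    hind.comp (fun i x => c i * x) (fun i => measurable_const_mul (c i))
  have hm : ∀ i, AEMeasurable (fun ω => c i * X i ω) μ := fun i =>
    (hX i).aemeasurable.const_mul _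
  have hb : ∀ s : ℝ, |s| * (R * d) ≤ 1 → ∀ i, |s * c i| * R ≤ 1 := by
    intro s hs i
    calc |s * c i| * R = |s| * (R * |c i|) := by rw [abs_mul]; ring
      _ ≤ |s| * (R * d) := by gcongr; exact hd i
      _ ≤ 1 := hs
  have hsum : (fun ω => ∑ i, c i * X i ω) = ∑ i, (fun ω => c i * X i ω) := by
    ext ω; simp
  refine ⟨?_, fun s hs => ?_, fun s hs => ?_⟩
  · rw [hsum]; exact Finset.aemeasurable_sum _ fun i _ => hm i
  · by_contra hcon
    -- Without integrability the mgf takes the default value 0, yet independence writes it as a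
    -- product of positive factors.
    refine (mgf_undef hcon).not_gt ?_
    rw [hsum, hi.mgf_sum₀ hm]
    refine Finset.prod_pos fun i _ => mgf_pos ?_
    simpa [mul_assoc] using (hX i).integrable (s * c i) (hb s hs i)
  · rw [hsum, hi.mgf_sum₀ hm]
    calc ∏ i, mgf (fun ω => c i * X i ω) μ s ≤ ∏ i, Real.exp ((s * c i) ^ 2 * V) := by
          refine Finset.prod_le_prod (fun i _ => mgf_nonneg) fun i _ => ?_
          rw [mgf_const_mul, mul_comm]
          exact (hX i).mgf_le _ (hb s hs i)
      _ = _ := by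
          rw [← Real.exp_sum, Finset.mul_sum, Finset.mul_sum]
          congr 1
          exact Finset.sum_congr rfl fun i _ => by ring

/-- Bernstein's inequality for weighted sums of i.i.d. sub-gamma variables. -/
theorem SubGamma.measure_abs_sum_gt_le {Ω E ι : Type*} [MeasurableSpace Ω] [MeasurableSpace E]
    [Fintype ι] {μ : Measure Ω} [IsProbabilityMeasure μ] {ν : Measure E} {Y : ι → Ω → E}
    (hY : ∀ i, HasLaw (Y i) ν μ) (hind : iIndepFun Y μ) {φ : E → ℝ} (hφm : Measurable φ)
    {V R τ : ℝ} (hφ : SubGamma φ ν V R) (hV : 0 < V) (hR : 0 ≤ R) (hτ : 0 ≤ τ)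
    {c : ι → ℝ} {d : ℝ} (hd0 : 0 ≤ d) (hd : ∀ i, |c i| ≤ d) :
    μ {ω | 2 * (√V * √(∑ i, c i ^ 2) * √τ + R * d * τ) < |∑ i, c i * φ (Y i ω)|}
      ≤ ENNReal.ofReal (2 * Real.exp (-τ)) := by
  rcases (Finset.sum_nonneg fun i _ => sq_nonneg (c i) : 0 ≤ ∑ i, c i ^ 2).lt_or_eq with h | h
  · rw [← Real.sqrt_mul hV.le]
    exact (SubGamma.sum_mul hR (fun i => hφ.comp_hasLaw (hY i))
      (hind.comp (fun _ => φ) fun _ => hφm) hd).measure_abs_gt_le (mul_pos hV h)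
      (mul_nonneg hR hd0) hτ
  -- The Chernoff bound requires a positive variance proxy, so vanishing weights are treated apart:
  -- the sum is then identically zero.
  · have hc : ∀ i, c i = 0 := by
      intro i
      have := (Finset.sum_eq_zero_iff_of_nonneg fun i _ => sq_nonneg (c i)).1 h.symm i
        (Finset.mem_univ i)
      exact pow_eq_zero_iff two_ne_zero |>.1 this
    have : ∀ ω, ¬ (2 * (√V * √(∑ i, c i ^ 2) * √τ + R * d * τ) < |∑ i, c i * φ (Y i ω)|) := by
      intro ω
      simp only [hc, zero_mul, Finset.sum_const_zero, abs_zero, not_lt]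
      positivity
    simp [this]

/-! ### Moment generating function of a product with one bounded factor -/

theorem Real.exp_le_one_add_add_sq_mul_exp_abs (y : ℝ) :
    Real.exp y ≤ 1 + y + y ^ 2 * Real.exp |y| := by
  have h0 : 1 - y ≤ Real.exp (-y) := by linarith [Real.add_one_le_exp (-y)]
  have h1 : Real.exp y * (1 - y) ≤ 1 := by
    calc _ ≤ Real.exp y * Real.exp (-y) := by gcongr
      _ = 1 := by rw [← Real.exp_add]; simp
  have h2 : y * (Real.exp y - 1) ≤ y ^ 2 * Real.exp |y| := by
    rcases le_total 0 y with hy | hy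
    · rw [abs_of_nonneg hy]
      nlinarith
    · have h3 : 1 ≤ Real.exp |y| := Real.one_le_exp (abs_nonneg _)
      have h4 := Real.add_one_le_exp y
      nlinarith [sq_nonneg y]
  nlinarith

theorem pow_four_mul_exp_le {h : ℝ} (hh : 0 ≤ h) :
    h ^ 4 * Real.exp (h / 8) ≤ 98304 * Real.exp (h / 4) := by
  -- The constant below is 98304 = 4! · 8⁴.
  have h1 := Real.pow_div_factorial_le_exp (h / 8) (by positivity) 4
  have h2 : h ^ 4 ≤ 98304 * Real.exp (h / 8) := by
    norm_num [Nat.factorial] at h1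
    linarith [show (h / 8) ^ 4 = h ^ 4 / 4096 by ring]
  calc h ^ 4 * Real.exp (h / 8) ≤ 98304 * Real.exp (h / 8) * Real.exp (h / 8) := by gcongr
    _ = 98304 * Real.exp (h / 4) := by rw [mul_assoc, ← Real.exp_add]; ring_nf

theorem abs_le_four_mul_exp {G h : ℝ} (hG : |G| ≤ h) : |G| ≤ 4 * Real.exp (h / 4) := by
  linarith [Real.add_one_le_exp (h / 4)]

theorem sq_mul_sq_le {a b S : ℝ} (hS : 0 < S) :
    a ^ 2 * b ^ 2 ≤ a ^ 4 / (2 * S) + S / 2 * b ^ 4 := by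
  have : a ^ 4 / (2 * S) + S / 2 * b ^ 4 - a ^ 2 * b ^ 2 = (a ^ 2 - S * b ^ 2) ^ 2 / (2 * S) := by
    field_simp; ring
  have : 0 ≤ (a ^ 2 - S * b ^ 2) ^ 2 / (2 * S) := by positivity
  linarith

section
variable {Ω : Type*} [MeasurableSpace Ω] {μ : Measure Ω} {F G h : Ω → ℝ}

theorem integrable_mul_of_abs_le_exp {K : ℝ} (hF : AEMeasurable F μ)
    (hG : AEMeasurable G μ) (hFK : ∀ ω, |F ω| ≤ K) (hGh : ∀ ω, |G ω| ≤ h ω)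
    (hint : Integrable (fun ω => Real.exp (h ω / 4)) μ) : Integrable (fun ω => F ω * G ω) μ := by
  refine (hint.const_mul (K * 4)).mono' (hF.mul hG).aestronglyMeasurable (.of_forall fun ω => ?_)
  rw [Real.norm_eq_abs, abs_mul, mul_assoc]
  have := abs_nonneg (F ω)
  gcongr
  · exact this.trans (hFK ω)
  · exact hFK ω
  · exact abs_le_four_mul_exp (hGh ω)

/-- The bound K on F limits only the range of s: it ensures |sFG| ≤ h/16. The second-order term
s²F²G²e^{|sFG|} is then split by weighted AM-GM into a part with F⁴ and a part with h⁴e^{h/8}. Both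
have controlled means, and the weight S makes the variance proxy proportional to S, not to K². -/
theorem subGamma_mul_sub_integral [IsProbabilityMeasure μ] {K S : ℝ} (hF : AEMeasurable F μ)
    (hG : AEMeasurable G μ) (hS : 0 < S)
    (hFK : ∀ ω, |F ω| ≤ K) (hF4 : ∫ ω, F ω ^ 4 ∂μ ≤ S ^ 2) (hGh : ∀ ω, |G ω| ≤ h ω)
    (hint : Integrable (fun ω => Real.exp (h ω / 4)) μ)
    (hexp : ∫ ω, Real.exp (h ω / 4) ∂μ ≤ 2) :
    SubGamma (fun ω => F ω * G ω - ∫ ω, F ω * G ω ∂μ) μ (100000 * S) (16 * K) := by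
  have hFG := integrable_mul_of_abs_le_exp hF hG hFK hGh hint
  have hb : ∀ s : ℝ, |s| * (16 * K) ≤ 1 → ∀ ω, |s * (F ω * G ω)| ≤ h ω / 16 := by
    intro s hs ω
    have hh0 : 0 ≤ h ω := (abs_nonneg _).trans (hGh ω)
    rw [abs_mul, abs_mul]
    calc |s| * (|F ω| * |G ω|) ≤ |s| * (K * h ω) := by
          have := abs_nonneg (F ω)
          gcongr
          · exact this.trans (hFK ω)
          · exact hFK ω
          · exact hGh ω
      _ = |s| * (16 * K) * h ω / 16 := by ring
      _ ≤ 1 * h ω / 16 := by gcongr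
      _ = _ := by ring
  have hi : ∀ s : ℝ, |s| * (16 * K) ≤ 1 → Integrable (fun ω => Real.exp (s * (F ω * G ω))) μ := by
    intro s hs
    refine hint.mono' ((hF.mul hG).const_mul s).exp.aestronglyMeasurable (.of_forall fun ω => ?_)
    rw [Real.norm_eq_abs, Real.abs_exp]
    refine Real.exp_le_exp.2 ?_
    have := hb s hs ω
    have h2 := (abs_nonneg _).trans (hGh ω)
    linarith [le_abs_self (s * (F ω * G ω))]
  have hF4i : Integrable (fun ω => F ω ^ 4) μ := by
    refine (integrable_const (K ^ 4)).mono' (hF.pow_const 4).aestronglyMeasurable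
      (.of_forall fun ω => ?_)
    rw [Real.norm_eq_abs, abs_pow]
    exact pow_le_pow_left₀ (abs_nonneg _) (hFK ω) 4
  set e := ∫ ω, F ω * G ω ∂μ
  have hsub : ∀ s : ℝ, (fun ω => Real.exp (s * (F ω * G ω - e)))
      = fun ω => Real.exp (-(s * e)) * Real.exp (s * (F ω * G ω)) := by
    intro s; ext ω; rw [← Real.exp_add]; ring_nf
  refine ⟨(hF.mul hG).sub_const _, fun s hs => ?_, fun s hs => ?_⟩
  · rw [hsub]; exact (hi s hs).const_mul _
  · rw [mgf, hsub, integral_const_mul]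
    have hpt : ∀ ω, Real.exp (s * (F ω * G ω)) ≤ 1 + s * (F ω * G ω)
        + (s ^ 2 / (2 * S) * F ω ^ 4 + s ^ 2 * S * 49152 * Real.exp (h ω / 4)) := by
      intro ω
      have hh0 : 0 ≤ h ω := (abs_nonneg _).trans (hGh ω)
      refine (Real.exp_le_one_add_add_sq_mul_exp_abs _).trans ?_
      gcongr
      have h1 : Real.exp |s * (F ω * G ω)| ≤ Real.exp (h ω / 8) :=
        Real.exp_le_exp.2 ((hb s hs ω).trans (by linarith))
      have h2 : |s * (F ω * G ω)| ^ 2 * Real.exp |s * (F ω * G ω)|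
          ≤ s ^ 2 * (F ω ^ 4 / (2 * S) * 1 + S / 2 * (h ω ^ 4 * Real.exp (h ω / 8))) := by
        have h3 : Real.exp |s * (F ω * G ω)| ≤ Real.exp (h ω / 16) :=
          Real.exp_le_exp.2 (hb s hs ω)
        -- The factor e^{h/16} is absorbed into the square as (e^{h/32})², so that the fourth power
        -- costs only e^{h/8}.
        have h4 := sq_mul_sq_le (a := F ω) (b := h ω * Real.exp (h ω / 32)) hS
        have h5 : Real.exp (h ω / 32) ^ 2 = Real.exp (h ω / 16) := by
          rw [← Real.exp_nat_mul]; congr 1; push_cast; ring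
        have h6 : Real.exp (h ω / 32) ^ 4 = Real.exp (h ω / 8) := by
          rw [← Real.exp_nat_mul]; congr 1; push_cast; ring
        rw [mul_pow, mul_pow, h5, h6] at h4
        have h7 : G ω ^ 2 ≤ h ω ^ 2 := sq_le_sq.2 (by rw [abs_of_nonneg hh0]; exact hGh ω)
        calc |s * (F ω * G ω)| ^ 2 * Real.exp |s * (F ω * G ω)|
            ≤ |s * (F ω * G ω)| ^ 2 * Real.exp (h ω / 16) := by gcongr
          _ = s ^ 2 * (F ω ^ 2 * (G ω ^ 2 * Real.exp (h ω / 16))) := by rw [sq_abs]; ring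
          _ ≤ s ^ 2 * (F ω ^ 2 * (h ω ^ 2 * Real.exp (h ω / 16))) := by gcongr
          _ ≤ _ := by rw [mul_one]; gcongr
      rw [sq_abs] at h2
      refine h2.trans ?_
      have h8 := pow_four_mul_exp_le hh0
      calc s ^ 2 * (F ω ^ 4 / (2 * S) * 1 + S / 2 * (h ω ^ 4 * Real.exp (h ω / 8)))
          ≤ s ^ 2 * (F ω ^ 4 / (2 * S) * 1 + S / 2 * (98304 * Real.exp (h ω / 4))) := by gcongr
        _ = _ := by ring
    have hint1 : Integrable (fun ω => 1 + s * (F ω * G ω)) μ :=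
      (integrable_const _).add (hFG.const_mul s)
    have hint2 : Integrable
        (fun ω => s ^ 2 / (2 * S) * F ω ^ 4 + s ^ 2 * S * 49152 * Real.exp (h ω / 4)) μ :=
      (hF4i.const_mul _).add (hint.const_mul _)
    have hle := integral_mono (hi s hs) (hint1.add hint2) hpt
    have heq : ∫ ω, (1 + s * (F ω * G ω)
        + (s ^ 2 / (2 * S) * F ω ^ 4 + s ^ 2 * S * 49152 * Real.exp (h ω / 4))) ∂μ
        = 1 + s * e + (s ^ 2 / (2 * S) * ∫ ω, F ω ^ 4 ∂μ
          + s ^ 2 * S * 49152 * ∫ ω, Real.exp (h ω / 4) ∂μ) := by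
      rw [integral_add hint1 hint2, integral_add (integrable_const _) (hFG.const_mul s),
        integral_add (hF4i.const_mul _) (hint.const_mul _)]
      simp [integral_const_mul, e]
    -- The second-order coefficient is 1/2 + 2 · 49152 = 98304.5, rounded up to 100000.
    have hle2 : ∫ ω, Real.exp (s * (F ω * G ω)) ∂μ ≤ 1 + s * e + s ^ 2 * (100000 * S) := by
      refine (hle.trans_eq heq).trans ?_
      have h1 : s ^ 2 / (2 * S) * ∫ ω, F ω ^ 4 ∂μ ≤ s ^ 2 / (2 * S) * S ^ 2 := by gcongr
      have h2 : s ^ 2 * S * 49152 * ∫ ω, Real.exp (h ω / 4) ∂μ ≤ s ^ 2 * S * 49152 * 2 := by gcongr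
      have h3 : s ^ 2 / (2 * S) * S ^ 2 = s ^ 2 * S / 2 := by field_simp
      have h4 : 0 ≤ s ^ 2 * S := by positivity
      linarith
    calc Real.exp (-(s * e)) * ∫ ω, Real.exp (s * (F ω * G ω)) ∂μ
        ≤ Real.exp (-(s * e)) * Real.exp (s * e + s ^ 2 * (100000 * S)) := by
          gcongr
          refine hle2.trans ?_
          linarith [Real.add_one_le_exp (s * e + s ^ 2 * (100000 * S))]
      _ = _ := by rw [← Real.exp_add]; ring_nf

end

/-! ### One-dimensional Gaussian integrals -/

theorem integrable_exp_sq_div_four_gaussianReal :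
    Integrable (fun x : ℝ => Real.exp (x ^ 2 / 4)) (gaussianReal 0 1) := by
  rw [gaussianReal_of_var_ne_zero 0 one_ne_zero, integrable_withDensity_iff
    (measurable_gaussianPDF 0 1) (.of_forall fun _ => gaussianPDF_lt_top)]
  have : (fun x : ℝ => Real.exp (x ^ 2 / 4) * (gaussianPDF 0 1 x).toReal)
      = fun x => (√(2 * Real.pi))⁻¹ * Real.exp (-(1 / 4) * x ^ 2) := by
    ext x
    rw [toReal_gaussianPDF, gaussianPDFReal, mul_left_comm, ← Real.exp_add]
    simp only [NNReal.coe_one, mul_one, sub_zero]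
    congr 2
    ring
  rw [this]
  exact (integrable_exp_neg_mul_sq (by norm_num)).const_mul _

theorem integral_exp_sq_div_four_gaussianReal :
    ∫ x : ℝ, Real.exp (x ^ 2 / 4) ∂(gaussianReal 0 1) = √2 := by
  rw [integral_gaussianReal_eq_integral_smul one_ne_zero]
  have : (fun x : ℝ => gaussianPDFReal 0 1 x • Real.exp (x ^ 2 / 4))
      = fun x => (√(2 * Real.pi))⁻¹ * Real.exp (-(1 / 4) * x ^ 2) := by
    ext x
    rw [gaussianPDFReal, smul_eq_mul, mul_assoc, ← Real.exp_add]
    simp only [NNReal.coe_one, mul_one, sub_zero]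
    congr 2
    ring
  rw [this, integral_const_mul, integral_gaussian, inv_mul_eq_div, ← Real.sqrt_div' _ (by positivity)]
  congr 1
  field_simp
  norm_num

theorem integral_exp_sq_div_four_gaussianReal_le :
    ∫ x : ℝ, Real.exp (x ^ 2 / 4) ∂(gaussianReal 0 1) ≤ 3 / 2 := by
  rw [integral_exp_sq_div_four_gaussianReal, Real.sqrt_le_left (by norm_num)]
  norm_num

theorem integral_sq_gaussianReal : ∫ x : ℝ, x ^ 2 ∂(gaussianReal 0 1) = 1 := by
  have := variance_fun_id_gaussianReal (μ := 0) (v := 1)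
  rwa [variance_eq_integral (by fun_prop), integral_id_gaussianReal, NNReal.coe_one,
    show (fun x : ℝ => (x - 0) ^ 2) = fun x => x ^ 2 by ext; simp] at this

theorem integrable_pow_gaussianReal (k : ℕ) :
    Integrable (fun x : ℝ => x ^ k) (gaussianReal 0 1) := by
  have := (memLp_id_gaussianReal' (μ := 0) (v := 1) (k : ℝ≥0∞) (by simp)).integrable_norm_pow'
  refine this.mono (by fun_prop) (.of_forall fun x => ?_)
  simp

theorem integrable_pow_mul_gaussianPDFReal (k : ℕ) :
    Integrable (fun x : ℝ => x ^ k * gaussianPDFReal 0 1 x) := by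
  have := integrable_pow_gaussianReal k
  rw [gaussianReal_of_var_ne_zero 0 one_ne_zero, integrable_withDensity_iff
    (measurable_gaussianPDF 0 1) (.of_forall fun _ => gaussianPDF_lt_top)] at this
  simpa [toReal_gaussianPDF] using this

theorem hasDerivAt_gaussianPDFReal (x : ℝ) :
    HasDerivAt (gaussianPDFReal 0 1) (-(x * gaussianPDFReal 0 1 x)) x := by
  have h : HasDerivAt (fun y : ℝ => -y ^ 2 / 2) (-x) x := by
    refine (((hasDerivAt_pow 2 x).neg.div_const 2)).congr_deriv ?_
    simp
    ring
  have h2 := (h.exp.const_mul (√(2 * Real.pi))⁻¹)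
  have e : gaussianPDFReal 0 1 = fun y => (√(2 * Real.pi))⁻¹ * Real.exp (-y ^ 2 / 2) := by
    ext y; simp [gaussianPDFReal]
  rw [e]
  refine h2.congr_deriv ?_
  ring

theorem integral_pow_four_gaussianReal : ∫ x : ℝ, x ^ 4 ∂(gaussianReal 0 1) = 3 := by
  have h2 := integral_sq_gaussianReal
  rw [integral_gaussianReal_eq_integral_smul one_ne_zero] at h2 ⊢
  simp only [smul_eq_mul] at h2 ⊢
  -- Since φ' = -xφ for the Gaussian density φ, integrating x³ · xφ by parts gives E x⁴ = 3 E x².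
  have key := integral_mul_deriv_eq_deriv_mul_of_integrable (u := fun x : ℝ => x ^ 3)
    (v := gaussianPDFReal 0 1) (u' := fun x => 3 * x ^ 2)
    (v' := fun x => -(x * gaussianPDFReal 0 1 x))
    (fun x _ => by simpa using hasDerivAt_pow 3 x) (fun x _ => hasDerivAt_gaussianPDFReal x)
    (by
      convert (integrable_pow_mul_gaussianPDFReal 4).neg using 1
      ext x; simp only [Pi.mul_apply, Pi.neg_apply]; ring)
    (by
      convert (integrable_pow_mul_gaussianPDFReal 2).const_mul 3 using 1
      ext x; simp only [Pi.mul_apply]; ring)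
    (integrable_pow_mul_gaussianPDFReal 3)
  have e1 : (fun x : ℝ => x ^ 3 * -(x * gaussianPDFReal 0 1 x))
      = fun x => -(gaussianPDFReal 0 1 x * x ^ 4) := by ext x; ring
  have e2 : (fun x : ℝ => 3 * x ^ 2 * gaussianPDFReal 0 1 x)
      = fun x => 3 * (gaussianPDFReal 0 1 x * x ^ 2) := by ext x; ring
  rw [e1, e2, integral_neg, integral_const_mul, h2] at key
  linarith

/-! ### Standard Gaussian vectors: linear forms and squared norm -/

theorem Matrix.posSemidef_smul_one {m : ℕ} {c : ℝ} (hc : 0 ≤ c) :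
    (c • (1 : Matrix (Fin m) (Fin m) ℝ)).PosSemidef :=
  Matrix.PosSemidef.one.smul hc

theorem hasLaw_sqrt_smul {Ω : Type*} [MeasurableSpace Ω] {P : Measure Ω} {N m : ℕ} (hN : 0 < N)
    {X : Ω → EuclideanSpace ℝ (Fin m)}
    (hX : HasLaw X (multivariateGaussian 0 ((1 / (N : ℝ)) • (1 : Matrix (Fin m) (Fin m) ℝ))) P) :
    HasLaw (fun ω => √(N : ℝ) • X ω) (stdGaussian (EuclideanSpace ℝ (Fin m))) P := by
  have hmeas : Measurable (fun x : EuclideanSpace ℝ (Fin m) => √(N : ℝ) • x) := by fun_prop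
  refine HasLaw.fun_comp (Y := fun x => √(N : ℝ) • x)
    ⟨hmeas.aemeasurable, ?_⟩ hX
  apply Measure.ext_of_charFun
  ext t
  rw [charFun_map_smul, charFun_multivariateGaussian (Matrix.posSemidef_smul_one (by positivity)),
    charFun_stdGaussian]
  congr 1
  have hN' : (N : ℝ) ≠ 0 := by positivity
  have h1 : (√(N : ℝ)) ^ 2 = N := Real.sq_sqrt (by positivity)
  have h2 : t.ofLp ⬝ᵥ t.ofLp = ‖t‖ ^ 2 := by
    rw [EuclideanSpace.real_norm_sq_eq]; simp [dotProduct, sq]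
  simp only [inner_zero_right, Complex.ofReal_zero, zero_mul, zero_sub, WithLp.ofLp_smul,
    Matrix.smul_mulVec, Matrix.one_mulVec, dotProduct_smul, smul_dotProduct, smul_eq_mul, h2]
  have h3 : 1 / (N : ℝ) * (√N * (√N * ‖t‖ ^ 2)) = ‖t‖ ^ 2 := by
    field_simp
    rw [h1]
  rw [h3]
  push_cast
  ring

section
variable {m : ℕ}

local notation "E" => EuclideanSpace ℝ (Fin m)
local notation "γ" => stdGaussian (EuclideanSpace ℝ (Fin m))

theorem map_inner_stdGaussian (u : E) :
    (γ).map (fun g => inner ℝ g u) = (gaussianReal 0 1).map (fun z => ‖u‖ * z) := by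
  have h1 : (fun g : E => inner ℝ g u) = ⇑(innerSL ℝ u) := by
    ext g; simp [real_inner_comm]
  rw [h1, IsGaussian.map_eq_gaussianReal, gaussianReal_map_const_mul, variance_dual_stdGaussian,
    integral_strongDual_stdGaussian]
  simp only [innerSL_apply_norm, mul_zero, mul_one]
  congr 1
  ext
  simp

theorem hasLaw_ofLp_stdGaussian :
    HasLaw (fun g : E => (fun i => g i)) (Measure.pi fun _ : Fin m => gaussianReal 0 1) (γ) := by
  refine ⟨by fun_prop, ?_⟩
  rw [← map_pi_eq_stdGaussian, Measure.map_map (by fun_prop) (by fun_prop)]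
  exact Measure.map_id

theorem hasLaw_eval_stdGaussian (j : Fin m) :
    HasLaw (fun g : E => g j) (gaussianReal 0 1) (γ) :=
  HasLaw.fun_comp (measurePreserving_eval (fun _ : Fin m => gaussianReal 0 1) j).hasLaw
    hasLaw_ofLp_stdGaussian

theorem iIndepFun_eval_stdGaussian : iIndepFun (fun (j : Fin m) (g : E) => g j) (γ) :=
  (iIndepFun_iff_hasLaw_pi_pi hasLaw_eval_stdGaussian).2 hasLaw_ofLp_stdGaussian

theorem map_neg_stdGaussian : (γ).map (fun g => -g) = γ :=
  stdGaussian_map (LinearIsometryEquiv.neg ℝ : E ≃ₗᵢ[ℝ] E)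

theorem integral_comp_neg_stdGaussian (φ : E → ℝ) : ∫ g, φ (-g) ∂(γ) = ∫ g, φ g ∂(γ) := by
  conv_rhs => rw [← map_neg_stdGaussian]
  exact ((MeasurableEquiv.neg E).measurableEmbedding.integral_map φ).symm

theorem integrable_exp_inner_sq {u : E} (hu : ‖u‖ ≤ 1) :
    Integrable (fun g : E => Real.exp ((inner ℝ g u) ^ 2 / 4)) (γ) ∧
      ∫ g : E, Real.exp ((inner ℝ g u) ^ 2 / 4) ∂(γ) ≤ 3 / 2 := by
  have hm : Measurable (fun x : ℝ => Real.exp (x ^ 2 / 4)) := by fun_prop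
  have hle : ∀ z : ℝ, Real.exp ((‖u‖ * z) ^ 2 / 4) ≤ Real.exp (z ^ 2 / 4) := by
    intro z
    refine Real.exp_le_exp.2 ?_
    have : ‖u‖ ^ 2 ≤ 1 := pow_le_one₀ (norm_nonneg u) hu
    rw [mul_pow]
    nlinarith [sq_nonneg z]
  have hi : Integrable (fun z : ℝ => Real.exp ((‖u‖ * z) ^ 2 / 4)) (gaussianReal 0 1) := by
    refine integrable_exp_sq_div_four_gaussianReal.mono' (by fun_prop) (.of_forall fun z => ?_)
    rw [Real.norm_eq_abs, Real.abs_exp]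
    exact hle z
  have hmap : Integrable (fun x : ℝ => Real.exp (x ^ 2 / 4))
      ((γ).map (fun g => inner ℝ g u)) := by
    rw [map_inner_stdGaussian, integrable_map_measure hm.aestronglyMeasurable (by fun_prop)]
    exact hi
  constructor
  · exact hmap.comp_measurable (by fun_prop)
  · calc ∫ g : E, Real.exp ((inner ℝ g u) ^ 2 / 4) ∂(γ)
        = ∫ x, Real.exp (x ^ 2 / 4) ∂((γ).map (fun g => inner ℝ g u)) :=
          (integral_map (by fun_prop) hm.aestronglyMeasurable).symm
      _ = ∫ z, Real.exp ((‖u‖ * z) ^ 2 / 4) ∂(gaussianReal 0 1) := by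
          rw [map_inner_stdGaussian, integral_map (by fun_prop) hm.aestronglyMeasurable]
      _ ≤ ∫ z, Real.exp (z ^ 2 / 4) ∂(gaussianReal 0 1) :=
          integral_mono hi integrable_exp_sq_div_four_gaussianReal hle
      _ ≤ 3 / 2 := integral_exp_sq_div_four_gaussianReal_le

theorem mgf_inner_stdGaussian (u : E) (s : ℝ) :
    Integrable (fun g : E => Real.exp (s * inner ℝ g u)) (γ) ∧
      mgf (fun g : E => inner ℝ g u) (γ) s = Real.exp (s ^ 2 * (‖u‖ ^ 2 / 2)) := by
  have hmap := map_inner_stdGaussian u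
  have h2 := hmap
  rw [gaussianReal_map_const_mul] at h2
  constructor
  · have h3 : Integrable (fun x : ℝ => Real.exp (s * x)) ((γ).map (fun g => inner ℝ g u)) := by
      rw [h2]; exact integrable_exp_mul_gaussianReal s
    exact h3.comp_measurable (by fun_prop)
  · rw [mgf_gaussianReal h2]
    simp
    ring

theorem subGamma_inner_stdGaussian {u : E} (hu : ‖u‖ ≤ 1) :
    SubGamma (fun g : E => inner ℝ g u) (γ) 1 0 where
  aemeasurable := by fun_prop
  integrable s _ := (mgf_inner_stdGaussian u s).1
  mgf_le s _ := by
    rw [(mgf_inner_stdGaussian u s).2]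
    have : ‖u‖ ^ 2 ≤ 1 := pow_le_one₀ (norm_nonneg u) hu
    gcongr
    linarith

/-- The centred squared norm `‖g‖² - m`. -/
noncomputable def normSqDev (g : E) : ℝ := ‖g‖ ^ 2 - m

theorem measurable_normSqDev : Measurable (normSqDev : E → ℝ) := by
  unfold normSqDev; fun_prop

theorem normSqDev_eq_sum (g : E) : normSqDev g = ∑ j, (g j ^ 2 - 1) := by
  simp [normSqDev, EuclideanSpace.real_norm_sq_eq]

theorem subGamma_sq_sub_one : SubGamma (fun x : ℝ => x ^ 2 - 1) (gaussianReal 0 1) 100000 16 := by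
  have := subGamma_mul_sub_integral (μ := gaussianReal 0 1) (F := fun _ => 1)
    (G := fun x : ℝ => x ^ 2) (h := fun x => x ^ 2) (K := 1) (S := 1) (by fun_prop) (by fun_prop)
    one_pos (by simp) (by simp) (by simp [abs_of_nonneg, sq_nonneg])
    integrable_exp_sq_div_four_gaussianReal
    (integral_exp_sq_div_four_gaussianReal_le.trans (by norm_num))
  simpa [integral_sq_gaussianReal] using this

/-- A sum of m independent copies of x² - 1. Writing m + 1 in place of m keeps the proxy positive
when m = 0. -/
theorem subGamma_normSqDev : SubGamma (normSqDev : E → ℝ) (γ) (100000 * (m + 1)) 16 := by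
  have := SubGamma.sum_mul (V := 100000) (R := 16) (by norm_num)
    (fun j : Fin m => subGamma_sq_sub_one.comp_hasLaw (hasLaw_eval_stdGaussian j))
    (iIndepFun_eval_stdGaussian.comp (fun _ x => x ^ 2 - 1) (fun _ => by fun_prop))
    (c := fun _ => 1) (d := 1) (by simp)
  have e : (fun g : E => ∑ j : Fin m, (1 : ℝ) * (g j ^ 2 - 1)) = normSqDev := by
    ext g; simp [normSqDev_eq_sum]
  rw [e] at this
  exact this.mono (by simp) (by norm_num)

/-- The fourth moment is read off the mgf at ±s through y⁴/24 ≤ e^y + e^{-y}. The bound is written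
as a square because it supplies S = 2000000(m + 1) in `subGamma_mul_sub_integral`. -/
theorem integral_normSqDev_pow_four :
    Integrable (fun g : E => normSqDev g ^ 4) (γ) ∧
      ∫ g : E, normSqDev g ^ 4 ∂(γ) ≤ (2000000 * (m + 1 : ℝ)) ^ 2 := by
  obtain ⟨r, hr, hrm⟩ : ∃ r : ℝ, 1 ≤ r ∧ r ^ 2 = m + 1 :=
    ⟨√(m + 1), by rw [Real.one_le_sqrt]; simp, Real.sq_sqrt (by positivity)⟩
  -- With r² = m + 1, this s is within the admissible range and has s²V = 100000/400² < 1, so both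
  -- mgf values are at most e ≤ 3.
  set s : ℝ := 1 / (400 * r) with hs
  have hs0 : 0 < s := by positivity
  have hs1 : s * 16 ≤ 1 := by
    rw [hs, div_mul_eq_mul_div, div_le_one (by positivity)]; linarith
  have hsV : s ^ 2 * (100000 * (m + 1)) ≤ 1 := by
    rw [← hrm, hs]; field_simp; norm_num
  have hW := subGamma_normSqDev (m := m)
  have hp : |s| * 16 ≤ 1 := by rwa [abs_of_pos hs0]
  have hn : |(-s)| * 16 ≤ 1 := by rwa [abs_neg]
  have e1 : Real.exp 1 ≤ 3 := (Real.exp_one_lt_d9.trans (by norm_num)).le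
  have b1 : ∫ g : E, Real.exp (s * normSqDev g) ∂(γ) ≤ 3 :=
    (hW.mgf_le s hp).trans ((Real.exp_le_exp.2 hsV).trans e1)
  have b2 : ∫ g : E, Real.exp (-s * normSqDev g) ∂(γ) ≤ 3 :=
    (hW.mgf_le (-s) hn).trans ((Real.exp_le_exp.2 (by rwa [neg_sq])).trans e1)
  have hpt : ∀ g : E, normSqDev g ^ 4
      ≤ 24 * (400 * r) ^ 4 * (Real.exp (s * normSqDev g) + Real.exp (-s * normSqDev g)) := by
    intro g
    have h1 := Real.pow_div_factorial_le_exp |s * normSqDev g| (abs_nonneg _) 4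
    have h2 := Real.exp_abs_le (s * normSqDev g)
    have h3 : |s * normSqDev g| ^ 4 = s ^ 4 * normSqDev g ^ 4 := by
      rw [Even.pow_abs (by decide), mul_pow]
    rw [h3] at h1
    norm_num [Nat.factorial, -abs_mul] at h1
    have h4 : s ^ 4 * normSqDev g ^ 4 ≤
        24 * (Real.exp (s * normSqDev g) + Real.exp (-s * normSqDev g)) := by
      rw [neg_mul]; linarith
    have h5 : normSqDev g ^ 4 = (400 * r) ^ 4 * (s ^ 4 * normSqDev g ^ 4) := by
      rw [hs]; field_simp
    rw [h5]
    calc _ ≤ (400 * r) ^ 4 * (24 * (Real.exp (s * normSqDev g) + Real.exp (-s * normSqDev g))) := by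
          gcongr
      _ = _ := by ring
  have hi : Integrable (fun g : E => 24 * (400 * r) ^ 4 *
      (Real.exp (s * normSqDev g) + Real.exp (-s * normSqDev g))) (γ) :=
    ((hW.integrable s hp).add (hW.integrable (-s) hn)).const_mul _
  have hi4 : Integrable (fun g : E => normSqDev g ^ 4) (γ) := by
    refine hi.mono' (measurable_normSqDev.pow_const 4).aestronglyMeasurable
      (.of_forall fun g => ?_)
    rw [Real.norm_eq_abs, abs_of_nonneg (by positivity)]
    exact hpt g
  refine ⟨hi4, (integral_mono hi4 hi hpt).trans ?_⟩
  rw [integral_const_mul, integral_add (hW.integrable s hp) (hW.integrable (-s) hn), ← hrm]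
  calc _ ≤ 24 * (400 * r) ^ 4 * (3 + 3) := by gcongr
    _ = 24 * 6 * 400 ^ 4 * r ^ 4 := by ring
    _ ≤ 2000000 ^ 2 * r ^ 4 := by gcongr; norm_num
    _ = _ := by ring
end

/-! ### Mixed moments of the centred squared norm -/

theorem integral_pow_three_gaussianReal : ∫ x : ℝ, x ^ 3 ∂(gaussianReal 0 1) = 0 := by
  have h : ∫ x : ℝ, x ^ 3 ∂(gaussianReal 0 1) = ∫ x : ℝ, (-x) ^ 3 ∂(gaussianReal 0 1) := by
    conv_lhs => rw [show gaussianReal 0 1 = (gaussianReal 0 1).map (fun x => -x) by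
      rw [gaussianReal_map_neg, neg_zero]]
    rw [integral_map (by fun_prop) (by fun_prop)]
  have h2 : (fun x : ℝ => (-x) ^ 3) = fun x => -x ^ 3 := by ext x; ring
  rw [h2, integral_neg] at h
  linarith

section
variable {m : ℕ}

local notation "E" => EuclideanSpace ℝ (Fin m)
local notation "γ" => stdGaussian (EuclideanSpace ℝ (Fin m))

/-- The integrand factors over the coordinates. If j ≠ k, the factor at j is odd; if j = k ≠ l, the
factor at l is the centred t² - 1. Only l = j = k survives, with value 3 - 1 = 2. -/
theorem integral_sq_sub_one_mul_eval_mul_eval (l j k : Fin m) :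
    Integrable (fun g : E => (g l ^ 2 - 1) * (g j * g k)) (γ) ∧
      ∫ g : E, (g l ^ 2 - 1) * (g j * g k) ∂(γ) = if j = k ∧ l = j then 2 else 0 := by
  let f : Fin m → ℝ → ℝ := fun i t =>
    (if i = l then t ^ 2 - 1 else 1) * ((if i = j then t else 1) * (if i = k then t else 1))
  have hprod : ∀ x : Fin m → ℝ, (x l ^ 2 - 1) * (x j * x k) = ∏ i, f i (x i) := by
    intro x
    simp only [f, Finset.prod_mul_distrib, Finset.prod_ite_eq', Finset.mem_univ, if_true]
  have hp : ∀ k : ℕ, Integrable (fun x : ℝ => x ^ k) (gaussianReal 0 1) :=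
    integrable_pow_gaussianReal
  have hfi : ∀ i, Integrable (f i) (gaussianReal 0 1) := by
    intro i
    have h1 := hp 1; have h2 := hp 2; have h3 := hp 3; have h4 := hp 4
    simp only [pow_one] at h1
    simp only [f]
    split_ifs <;> try simp only [one_mul, mul_one]
    · convert h4.sub h2 using 1; ext x; simp only [Pi.sub_apply]; ring
    · convert h3.sub h1 using 1; ext x; simp only [Pi.sub_apply]; ring
    · convert h3.sub h1 using 1; ext x; simp only [Pi.sub_apply]; ring
    · exact h2.sub (integrable_const _)
    · convert h2 using 1; ext x; ring
    · exact h1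
    · exact h1
    · exact integrable_const _
  have hlaw := hasLaw_ofLp_stdGaussian (m := m)
  have hI : Integrable (fun x : Fin m → ℝ => (x l ^ 2 - 1) * (x j * x k))
      (Measure.pi fun _ : Fin m => gaussianReal 0 1) := by
    simp only [hprod]
    exact Integrable.fintype_prod (fun i => hfi i)
  constructor
  · rw [← hlaw.map_eq] at hI
    exact hI.comp_aemeasurable hlaw.aemeasurable
  · have h1 : ∫ g : E, (g l ^ 2 - 1) * (g j * g k) ∂(γ)
        = ∫ x, (x l ^ 2 - 1) * (x j * x k) ∂(Measure.pi fun _ : Fin m => gaussianReal 0 1) := by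
      rw [← hlaw.map_eq] at hI ⊢
      exact (integral_map hlaw.aemeasurable hI.aestronglyMeasurable).symm
    rw [h1]
    simp only [hprod]
    rw [integral_fintype_prod_eq_prod (f := f)]
    by_cases hjk : j = k
    · subst hjk
      by_cases hlj : l = j
      · subst hlj
        rw [if_pos ⟨rfl, rfl⟩, Finset.prod_eq_single l]
        · simp only [f, if_true]
          have e : (fun x : ℝ => (x ^ 2 - 1) * (x * x)) = fun x => x ^ 4 - x ^ 2 := by
            ext x; ring
          rw [e, integral_sub (hp 4) (hp 2), integral_pow_four_gaussianReal,
            integral_sq_gaussianReal]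
          norm_num
        · intro i _ hi
          simp [f, hi]
        · simp
      · rw [if_neg (by simp [hlj])]
        refine Finset.prod_eq_zero (Finset.mem_univ l) ?_
        simp only [f, if_true, if_neg hlj, mul_one]
        rw [integral_sub (hp 2) (integrable_const _), integral_sq_gaussianReal]
        simp
    · rw [if_neg (by simp [hjk])]
      refine Finset.prod_eq_zero (Finset.mem_univ j) ?_
      simp only [f, if_true, if_neg hjk, mul_one]
      split_ifs
      · have e : (fun x : ℝ => (x ^ 2 - 1) * x) = fun x => x ^ 3 - x ^ 1 := by
          ext x; ring
        rw [e, integral_sub (hp 3) (hp 1), integral_pow_three_gaussianReal]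
        simp
      · simp

theorem integral_inner_mul_inner (u w : E) :
    ∫ g : E, inner ℝ g u * inner ℝ g w ∂(γ) = inner ℝ u w := by
  have h := covarianceBilin_apply (μ := γ) IsGaussian.memLp_two_id u w
  rw [covarianceBilin_stdGaussian] at h
  simp only [id_eq, integral_id_stdGaussian, sub_zero] at h
  rw [← innerSL_apply_apply ℝ u w, h]
  simp only [real_inner_comm]

/-- Expansion in coordinates leaves only the diagonal terms. This 2, with the 1 from the covariance
when ‖v‖ = 1, accounts for the 3/N subtracted in the matrix. -/
theorem integral_normSqDev_mul_inner_mul_inner (u w : E) :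
    ∫ g : E, normSqDev g * (inner ℝ g u * inner ℝ g w) ∂(γ) = 2 * inner ℝ u w := by
  have e : ∀ g : E, normSqDev g * (inner ℝ g u * inner ℝ g w)
      = ∑ l, ∑ j, ∑ k, u j * w k * ((g l ^ 2 - 1) * (g j * g k)) := by
    intro g
    rw [normSqDev_eq_sum, Finset.sum_mul]
    refine Finset.sum_congr rfl fun l _ => ?_
    simp only [PiLp.inner_apply, RCLike.inner_apply, conj_trivial]
    rw [Finset.sum_mul_sum, Finset.mul_sum]
    simp only [Finset.mul_sum]
    refine Finset.sum_congr rfl fun j _ => Finset.sum_congr rfl fun k _ => ?_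
    ring
  have hi : ∀ l j k, Integrable (fun g : E => u j * w k * ((g l ^ 2 - 1) * (g j * g k))) (γ) :=
    fun l j k => (integral_sq_sub_one_mul_eval_mul_eval l j k).1.const_mul _
  simp only [e]
  rw [integral_finsetSum _ fun l _ => integrable_finsetSum _ fun j _ =>
    integrable_finsetSum _ fun k _ => hi l j k]
  have e2 : ∀ l, ∫ g : E, ∑ j, ∑ k, u j * w k * ((g l ^ 2 - 1) * (g j * g k)) ∂(γ)
      = 2 * (u l * w l) := by
    intro l
    rw [integral_finsetSum _ fun j _ => integrable_finsetSum _ fun k _ => hi l j k]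
    have : ∀ j, ∫ g : E, ∑ k, u j * w k * ((g l ^ 2 - 1) * (g j * g k)) ∂(γ)
        = if l = j then 2 * (u j * w j) else 0 := by
      intro j
      rw [integral_finsetSum _ fun k _ => hi l j k]
      simp only [integral_const_mul, (integral_sq_sub_one_mul_eval_mul_eval l j _).2]
      by_cases hlj : l = j
      · simp [hlj]; ring
      · simp [hlj]
    simp [this]
  simp only [e2, PiLp.inner_apply, RCLike.inner_apply, conj_trivial, Finset.mul_sum]
  refine Finset.sum_congr rfl fun j _ => ?_
  ring

end

/-! ### Truncation of the centred squared norm -/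

section
variable {m : ℕ}

local notation "E" => EuclideanSpace ℝ (Fin m)
local notation "γ" => stdGaussian (EuclideanSpace ℝ (Fin m))

/-- The centred squared norm `‖g‖² - m` truncated at level `K`. -/
noncomputable def truncDev (K : ℝ) (g : E) : ℝ := max (-K) (min K (normSqDev g))

theorem measurable_truncDev (K : ℝ) : Measurable (truncDev K : E → ℝ) :=
  measurable_const.max (measurable_const.min measurable_normSqDev)

theorem abs_truncDev_le {K : ℝ} (hK : 0 ≤ K) (g : E) : |truncDev K g| ≤ K := by
  rw [abs_le]
  exact ⟨le_max_left _ _, max_le (by linarith) (min_le_left _ _)⟩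

theorem truncDev_eq {K : ℝ} {g : E} (h : |normSqDev g| ≤ K) : truncDev K g = normSqDev g := by
  rw [abs_le] at h
  rw [truncDev, min_eq_right h.2, max_eq_right h.1]

theorem abs_truncDev_le_abs {K : ℝ} (hK : 0 ≤ K) (g : E) : |truncDev K g| ≤ |normSqDev g| := by
  by_cases h : |normSqDev g| ≤ K
  · rw [truncDev_eq h]
  · exact (abs_truncDev_le hK g).trans (not_le.1 h).le

theorem abs_truncDev_sub_le {K : ℝ} (hK : 0 ≤ K) (g : E) :
    |truncDev K g - normSqDev g| ≤ |normSqDev g| := by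
  rcases le_or_gt |normSqDev g| K with h | h
  · rw [truncDev_eq h]; simp
  · rcases lt_abs.1 h with h1 | h1
    · have h2 : truncDev K g = K := by
        rw [truncDev, min_eq_left h1.le, max_eq_right (by linarith)]
      rw [h2, abs_of_nonpos (by linarith), abs_of_nonneg (by linarith)]; linarith
    · have h2 : truncDev K g = -K := by
        rw [truncDev, min_eq_right (by linarith), max_eq_left (by linarith)]
      rw [h2, abs_of_nonneg (by linarith), abs_of_nonpos (by linarith)]; linarith

theorem normSqDev_neg (g : E) : normSqDev (-g) = normSqDev g := by simp [normSqDev]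

theorem truncDev_neg (K : ℝ) (g : E) : truncDev K (-g) = truncDev K g := by
  simp [truncDev, normSqDev_neg]

theorem integral_truncDev_pow_four_le {K : ℝ} (hK : 0 ≤ K) :
    ∫ g : E, truncDev K g ^ 4 ∂(γ) ≤ (2000000 * (m + 1 : ℝ)) ^ 2 := by
  refine le_trans (integral_mono_of_nonneg (.of_forall fun g => by positivity)
    integral_normSqDev_pow_four.1 (.of_forall fun g => ?_)) integral_normSqDev_pow_four.2
  have := pow_le_pow_left₀ (abs_nonneg _) (abs_truncDev_le_abs hK g) 4
  rwa [Even.pow_abs (by decide), Even.pow_abs (by decide)] at this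

theorem abs_mul_le_half_add_sq (x y : ℝ) : |x * y| ≤ (x ^ 2 + y ^ 2) / 2 := by
  rw [abs_le]
  constructor <;> nlinarith [sq_nonneg (x - y), sq_nonneg (x + y)]

theorem exp_half_add_le (x y : ℝ) :
    Real.exp ((x + y) / 2 / 4) ≤ (Real.exp (x / 4) + Real.exp (y / 4)) / 2 := by
  have h1 : Real.exp (x / 4) = Real.exp (x / 8) ^ 2 := by
    rw [← Real.exp_nat_mul]; congr 1; push_cast; ring
  have h2 : Real.exp (y / 4) = Real.exp (y / 8) ^ 2 := by
    rw [← Real.exp_nat_mul]; congr 1; push_cast; ring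
  have h3 : Real.exp ((x + y) / 2 / 4) = Real.exp (x / 8) * Real.exp (y / 8) := by
    rw [← Real.exp_add]; congr 1; ring
  rw [h1, h2, h3]
  nlinarith [sq_nonneg (Real.exp (x / 8) - Real.exp (y / 8))]

theorem integrable_exp_inner_sq_add {u w : E} (hu : ‖u‖ ≤ 1) (hw : ‖w‖ ≤ 1) :
    Integrable (fun g : E => Real.exp (((inner ℝ g u) ^ 2 + (inner ℝ g w) ^ 2) / 2 / 4)) (γ) ∧
      ∫ g : E, Real.exp (((inner ℝ g u) ^ 2 + (inner ℝ g w) ^ 2) / 2 / 4) ∂(γ) ≤ 2 := by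
  obtain ⟨iu, bu⟩ := integrable_exp_inner_sq hu
  obtain ⟨iw, bw⟩ := integrable_exp_inner_sq hw
  have hi := (iu.add iw).div_const 2
  have hle : ∀ g : E, Real.exp (((inner ℝ g u) ^ 2 + (inner ℝ g w) ^ 2) / 2 / 4)
      ≤ (Real.exp ((inner ℝ g u) ^ 2 / 4) + Real.exp ((inner ℝ g w) ^ 2 / 4)) / 2 :=
    fun g => exp_half_add_le _ _
  have hi2 : Integrable
      (fun g : E => Real.exp (((inner ℝ g u) ^ 2 + (inner ℝ g w) ^ 2) / 2 / 4)) (γ) := by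
    refine hi.mono' (by fun_prop) (.of_forall fun g => ?_)
    rw [Real.norm_eq_abs, Real.abs_exp]
    exact hle g
  refine ⟨hi2, (integral_mono hi2 hi hle).trans ?_⟩
  simp only [Pi.add_apply]
  rw [integral_div, integral_add iu iw]
  linarith

theorem subGamma_inner_mul_inner {u w : E} (hu : ‖u‖ ≤ 1) (hw : ‖w‖ ≤ 1) :
    SubGamma (fun g : E => inner ℝ g u * inner ℝ g w - inner ℝ u w) (γ) 100000 16 := by
  obtain ⟨hi, hb⟩ := integrable_exp_inner_sq_add hu hw
  have := subGamma_mul_sub_integral (μ := γ) (F := fun _ => 1)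
    (G := fun g => inner ℝ g u * inner ℝ g w) (K := 1) (S := 1) (by fun_prop) (by fun_prop)
    one_pos (by simp) (by simp) (fun g => abs_mul_le_half_add_sq _ _) hi hb
  simpa [integral_inner_mul_inner] using this

theorem subGamma_truncDev_mul_inner_mul_inner {K : ℝ} (hK : 0 ≤ K) {u w : E} (hu : ‖u‖ ≤ 1)
    (hw : ‖w‖ ≤ 1) :
    SubGamma (fun g : E => truncDev K g * (inner ℝ g u * inner ℝ g w)
      - ∫ g : E, truncDev K g * (inner ℝ g u * inner ℝ g w) ∂(γ)) (γ)
      (100000 * (2000000 * (m + 1))) (16 * K) := by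
  obtain ⟨hi, hb⟩ := integrable_exp_inner_sq_add hu hw
  exact subGamma_mul_sub_integral (measurable_truncDev K).aemeasurable (by fun_prop) (by positivity)
    (abs_truncDev_le hK) (integral_truncDev_pow_four_le hK)
    (fun g => abs_mul_le_half_add_sq _ _) hi hb

/-- Truncation preserves evenness in g, so against a linear form it creates no bias. -/
theorem integral_truncDev_mul_inner (K : ℝ) (u : E) :
    ∫ g : E, truncDev K g * inner ℝ g u ∂(γ) = 0 := by
  have h := integral_comp_neg_stdGaussian (fun g : E => truncDev K g * inner ℝ g u)
  simp only [truncDev_neg, inner_neg_left, mul_neg, integral_neg] at h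
  linarith

theorem subGamma_truncDev_mul_inner {K : ℝ} (hK : 0 ≤ K) {u : E} (hu : ‖u‖ ≤ 1) :
    SubGamma (fun g : E => truncDev K g * inner ℝ g u) (γ)
      (100000 * (2000000 * (m + 1))) (16 * K) := by
  obtain ⟨iu, bu⟩ := integrable_exp_inner_sq hu
  have hle : ∀ g : E, Real.exp ((1 + inner ℝ g u ^ 2) / 2 / 4)
      ≤ (Real.exp (1 / 4) + Real.exp (inner ℝ g u ^ 2 / 4)) / 2 := fun g => exp_half_add_le _ _
  have hi : Integrable (fun g : E => (Real.exp (1 / 4) + Real.exp (inner ℝ g u ^ 2 / 4)) / 2) (γ) :=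
    ((integrable_const _).add iu).div_const 2
  have hi2 : Integrable (fun g : E => Real.exp ((1 + inner ℝ g u ^ 2) / 2 / 4)) (γ) := by
    refine hi.mono' (by fun_prop) (.of_forall fun g => ?_)
    rw [Real.norm_eq_abs, Real.abs_exp]
    exact hle g
  have hb : ∫ g : E, Real.exp ((1 + inner ℝ g u ^ 2) / 2 / 4) ∂(γ) ≤ 2 := by
    refine (integral_mono hi2 hi hle).trans ?_
    rw [integral_div, integral_add (integrable_const _) iu]
    have : Real.exp (1 / 4) ≤ 2 := by
      have h1 : Real.exp (1 / 4) ^ 4 = Real.exp 1 := by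
        rw [← Real.exp_nat_mul]; congr 1; norm_num
      have h2 := Real.exp_one_lt_d9
      refine le_of_pow_le_pow_left₀ (n := 4) (by norm_num) (by norm_num) ?_
      rw [h1]; linarith
    simp only [integral_const, probReal_univ, smul_eq_mul, one_mul]
    linarith
  have := subGamma_mul_sub_integral (G := fun g : E => inner ℝ g u)
    (measurable_truncDev K).aemeasurable (by fun_prop) (by positivity)
    (abs_truncDev_le hK) (integral_truncDev_pow_four_le hK)
    (fun g => by simpa using abs_mul_le_half_add_sq 1 (inner ℝ g u)) (by simpa using hi2)
    (by simpa using hb)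
  simpa [integral_truncDev_mul_inner] using this

/-- Compared with `subGamma_truncDev_mul_inner`, this gives up the variance proxy of order m for K²
but removes the linear range term. By symmetry under g ↦ -g the mgf is the mean of cosh, which is
monotone in the absolute value, so the truncated factor may be replaced by K. -/
theorem subGamma_truncDev_mul_inner_zero {K : ℝ} (hK : 0 ≤ K) {u : E} (hu : ‖u‖ ≤ 1) :
    SubGamma (fun g : E => truncDev K g * inner ℝ g u) (γ) (K ^ 2) 0 := by
  have hm : Measurable (fun g : E => truncDev K g * inner ℝ g u) :=
    (measurable_truncDev K).mul (by fun_prop)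
  have hx := fun s => mgf_inner_stdGaussian u s
  have hcosh : ∀ (s : ℝ) (g : E), Real.exp (s * (truncDev K g * inner ℝ g u))
      + Real.exp (-s * (truncDev K g * inner ℝ g u))
      ≤ Real.exp ((s * K) * inner ℝ g u) + Real.exp ((-(s * K)) * inner ℝ g u) := by
    intro s g
    have h1 : Real.cosh (s * (truncDev K g * inner ℝ g u)) ≤ Real.cosh ((s * K) * inner ℝ g u) := by
      rw [Real.cosh_le_cosh, abs_mul, abs_mul, abs_mul, abs_mul, ← mul_assoc, abs_of_nonneg hK]
      gcongr
      exact abs_truncDev_le hK g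
    rw [Real.cosh_eq, Real.cosh_eq] at h1
    rw [neg_mul, neg_mul]
    linarith
  have hi : ∀ s : ℝ, Integrable (fun g : E => Real.exp (s * (truncDev K g * inner ℝ g u))) (γ) := by
    intro s
    refine ((hx (s * K)).1.add (hx (-(s * K))).1).mono' (hm.const_mul s).exp.aestronglyMeasurable
      (.of_forall fun g => ?_)
    rw [Real.norm_eq_abs, Real.abs_exp]
    refine le_trans ?_ (hcosh s g)
    linarith [Real.exp_pos (-s * (truncDev K g * inner ℝ g u))]
  refine ⟨hm.aemeasurable, fun s _ => hi s, fun s _ => ?_⟩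
  have hsym : ∫ g : E, Real.exp (-s * (truncDev K g * inner ℝ g u)) ∂(γ)
      = ∫ g : E, Real.exp (s * (truncDev K g * inner ℝ g u)) ∂(γ) := by
    rw [← integral_comp_neg_stdGaussian]
    simp only [truncDev_neg, inner_neg_left, mul_neg, neg_mul, neg_neg]
  have h1 := integral_mono ((hi s).add (hi (-s))) ((hx (s * K)).1.add (hx (-(s * K))).1) (hcosh s)
  simp only [Pi.add_apply] at h1
  rw [integral_add (hi s) (hi (-s)), integral_add (hx (s * K)).1 (hx (-(s * K))).1, hsym] at h1
  have h2 := (hx (s * K)).2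
  have h3 := (hx (-(s * K))).2
  rw [mgf] at h2 h3 ⊢
  rw [h2, h3, neg_sq] at h1
  have h4 : Real.exp ((s * K) ^ 2 * (‖u‖ ^ 2 / 2)) ≤ Real.exp (s ^ 2 * K ^ 2) := by
    have : ‖u‖ ^ 2 ≤ 1 := pow_le_one₀ (norm_nonneg u) hu
    rw [mul_pow]
    refine Real.exp_le_exp.2 (mul_le_of_le_one_right (by positivity) (by linarith))
  linarith

/-- The two integrands differ only where |‖g‖² - m| > K. There the difference y satisfies y ≤
(a/2)y² + 1/(2a): the second moment of y is controlled by the fourth moment of the deviation, and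
the constant is paid only on an event of probability at most q. The weight a is left free for
optimisation. -/
theorem abs_integral_truncDev_mul_inner_mul_inner_sub_le {K q a : ℝ} (hK : 0 ≤ K) (ha : 0 < a)
    (hq : (γ).real {g : E | K < |normSqDev g|} ≤ q) {u w : E} (hu : ‖u‖ ≤ 1) (hw : ‖w‖ ≤ 1) :
    |∫ g : E, truncDev K g * (inner ℝ g u * inner ℝ g w) ∂(γ) - 2 * inner ℝ u w|
      ≤ 50000 * a * (2000000 * (m + 1)) + q / (2 * a) := by
  obtain ⟨hi, hb⟩ := integrable_exp_inner_sq_add hu hw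
  set S : ℝ := 2000000 * (m + 1) with hSdef
  have hS : 0 < S := by positivity
  obtain ⟨i4, b4⟩ := integral_normSqDev_pow_four (m := m)
  set h : E → ℝ := fun g => ((inner ℝ g u) ^ 2 + (inner ℝ g w) ^ 2) / 2
  have hG : ∀ g : E, |inner ℝ g u * inner ℝ g w| ≤ h g := fun g => abs_mul_le_half_add_sq _ _
  set A : Set E := {g : E | K < |normSqDev g|}
  have hA : MeasurableSet A := measurableSet_lt measurable_const measurable_normSqDev.abs
  set D : E → ℝ := fun g => normSqDev g ^ 4 / (2 * S) + S / 2 * (98304 * Real.exp (h g / 4))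
  have hDi : Integrable D (γ) := (i4.div_const _).add ((hi.const_mul _).const_mul _)
  have hDb : ∫ g, D g ∂(γ) ≤ 100000 * S := by
    simp only [D]
    rw [integral_add (i4.div_const _) ((hi.const_mul _).const_mul _), integral_div,
      integral_const_mul, integral_const_mul]
    have h1 : (∫ g : E, normSqDev g ^ 4 ∂(γ)) / (2 * S) ≤ S ^ 2 / (2 * S) := by gcongr
    have h2 : S ^ 2 / (2 * S) = S / 2 := by field_simp
    have h3 : S / 2 * (98304 * ∫ g : E, Real.exp (h g / 4) ∂(γ)) ≤ S / 2 * (98304 * 2) := by gcongr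
    linarith
  have hD : ∀ g, normSqDev g ^ 2 * (inner ℝ g u * inner ℝ g w) ^ 2 ≤ D g := by
    intro g
    have hh0 : 0 ≤ h g := (abs_nonneg _).trans (hG g)
    have h1 : (inner ℝ g u * inner ℝ g w) ^ 2 ≤ h g ^ 2 := by
      rw [← sq_abs]; exact pow_le_pow_left₀ (abs_nonneg _) (hG g) 2
    have h2 := sq_mul_sq_le (a := normSqDev g) (b := h g) hS
    have h3 : h g ^ 4 ≤ 98304 * Real.exp (h g / 4) := by
      have h4 := pow_four_mul_exp_le hh0
      have h5 : 1 ≤ Real.exp (h g / 8) := Real.one_le_exp (by positivity)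
      exact (le_mul_of_one_le_right (by positivity) h5).trans h4
    calc _ ≤ normSqDev g ^ 2 * h g ^ 2 := by gcongr
      _ ≤ _ := h2
      _ ≤ _ := by simp only [D]; gcongr
  have hmG : Measurable (fun g : E => inner ℝ g u * inner ℝ g w) := by fun_prop
  have hWi : Integrable (fun g : E => normSqDev g * (inner ℝ g u * inner ℝ g w)) (γ) := by
    refine (hDi.add (integrable_const 1)).mono'
      (measurable_normSqDev.mul hmG).aestronglyMeasurable (.of_forall fun g => ?_)
    rw [Real.norm_eq_abs]
    have h1 := hD g
    rw [← mul_pow] at h1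
    simp only [Pi.add_apply]
    rw [abs_le]
    constructor <;>
      nlinarith [sq_nonneg (normSqDev g * (inner ℝ g u * inner ℝ g w) - 1),
        sq_nonneg (normSqDev g * (inner ℝ g u * inner ℝ g w) + 1)]
  have hTi : Integrable (fun g : E => truncDev K g * (inner ℝ g u * inner ℝ g w)) (γ) :=
    integrable_mul_of_abs_le_exp (measurable_truncDev K).aemeasurable hmG.aemeasurable
      (abs_truncDev_le hK) hG hi
  rw [← integral_normSqDev_mul_inner_mul_inner, ← integral_sub hTi hWi]
  have hpt : ∀ g : E, |truncDev K g * (inner ℝ g u * inner ℝ g w)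
      - normSqDev g * (inner ℝ g u * inner ℝ g w)|
      ≤ a / 2 * D g + 1 / (2 * a) * A.indicator (fun _ => (1 : ℝ)) g := by
    intro g
    have hD0 : 0 ≤ D g := le_trans (by positivity) (hD g)
    by_cases hg : g ∈ A
    · rw [Set.indicator_of_mem hg, ← sub_mul, abs_mul]
      set y := |normSqDev g| * |inner ℝ g u * inner ℝ g w| with hy
      have h1 : |truncDev K g - normSqDev g| * |inner ℝ g u * inner ℝ g w| ≤ y := by
        exact mul_le_mul_of_nonneg_right (abs_truncDev_sub_le hK g) (abs_nonneg _)
      have h2 : y ^ 2 ≤ D g := by rw [hy, mul_pow, sq_abs, sq_abs]; exact hD g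
      refine h1.trans ?_
      have h3 : a / 2 * y ^ 2 + 1 / (2 * a) * 1 - y = (a * y - 1) ^ 2 / (2 * a) := by
        field_simp; ring
      have h4 : 0 ≤ (a * y - 1) ^ 2 / (2 * a) := by positivity
      have h5 : a / 2 * y ^ 2 ≤ a / 2 * D g := by gcongr
      linarith
    · rw [Set.indicator_of_notMem hg, truncDev_eq (not_lt.1 hg), sub_self, abs_zero]
      positivity
  have hAi : Integrable (A.indicator (fun _ => (1 : ℝ))) (γ) := (integrable_const 1).indicator hA
  refine (abs_integral_le_integral_abs).trans
    ((integral_mono (hTi.sub hWi).abs ((hDi.const_mul _).add (hAi.const_mul _)) hpt).trans ?_)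
  simp only [Pi.add_apply]
  rw [integral_add (hDi.const_mul _) (hAi.const_mul _), integral_const_mul, integral_const_mul,
    integral_indicator_const _ hA, smul_eq_mul, mul_one]
  have h1 : a / 2 * ∫ g, D g ∂(γ) ≤ a / 2 * (100000 * S) := by gcongr
  have h2 : 1 / (2 * a) * (γ).real A ≤ 1 / (2 * a) * q := by gcongr
  have h3 : 1 / (2 * a) * q = q / (2 * a) := by ring
  linarith

end

/-! ### Nets and union bounds -/

/-- The unit ball of a `d`-dimensional space has a `1/2`-net with at most `5 ^ d` points. -/
theorem exists_half_net (F : Type*) [NormedAddCommGroup F] [NormedSpace ℝ F]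
    [FiniteDimensional ℝ F] :
    ∃ T : Finset F, T.card ≤ 5 ^ Module.finrank ℝ F ∧ (∀ c ∈ T, ‖c‖ ≤ 1) ∧
      ∀ x : F, ‖x‖ ≤ 1 → ∃ c ∈ T, ‖x - c‖ ≤ 1 / 2 := by
  classical
  let Sep : ℕ → Prop := fun k => ∃ T : Finset F, T.card = k ∧ (∀ c ∈ T, ‖c‖ ≤ 1) ∧
    ∀ c ∈ T, ∀ d ∈ T, c ≠ d → 1 / 2 ≤ ‖c - d‖
  have hcard : ∀ T : Finset F, (∀ c ∈ T, ‖c‖ ≤ 1) →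
      (∀ c ∈ T, ∀ d ∈ T, c ≠ d → 1 / 2 ≤ ‖c - d‖) → T.card ≤ 5 ^ Module.finrank ℝ F := by
    intro T h1 h2
    -- Dilation by 2 yields 1-separated points in the ball of radius 2, the normalisation of the
    -- Besicovitch packing bound 5^d.
    have hinj : Function.Injective (fun x : F => (2 : ℝ) • x) := smul_right_injective F two_ne_zero
    rw [← Finset.card_image_of_injective T hinj]
    refine Besicovitch.card_le_of_separated _ ?_ ?_
    · intro c hc
      obtain ⟨x, hx, rfl⟩ := Finset.mem_image.1 hc
      rw [norm_smul]
      simpa using h1 x hx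
    · intro c hc d hd hcd
      obtain ⟨x, hx, rfl⟩ := Finset.mem_image.1 hc
      obtain ⟨y, hy, rfl⟩ := Finset.mem_image.1 hd
      have := h2 x hx y hy (fun h => hcd (by rw [h]))
      rw [← smul_sub, norm_smul, Real.norm_ofNat]
      linarith
  have hbdd : ∀ k, Sep k → k ≤ 5 ^ Module.finrank ℝ F := by
    rintro k ⟨T, rfl, h1, h2⟩
    exact hcard T h1 h2
  have h0 : Sep 0 := ⟨∅, by simp⟩
  obtain ⟨T, hT, h1, h2⟩ := Nat.findGreatest_spec (P := Sep) (Nat.zero_le _) h0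
  refine ⟨T, hcard T h1 h2, h1, fun x hx => ?_⟩
  by_contra! hcon
  have hxT : x ∉ T := fun h => by
    have := hcon x h
    norm_num at this
  have hS : Sep (T.card + 1) := by
    refine ⟨insert x T, Finset.card_insert_of_notMem hxT, ?_, ?_⟩
    · intro c hc
      rcases Finset.mem_insert.1 hc with rfl | hc
      · exact hx
      · exact h1 c hc
    · intro c hc d hd hcd
      rw [Finset.mem_insert] at hc hd
      rcases hc with rfl | hc
      · rcases hd with rfl | hd
        · exact absurd rfl hcd
        · exact (hcon d hd).le
      · rcases hd with rfl | hd
        · rw [norm_sub_rev]; exact (hcon c hc).le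
        · exact h2 c hc d hd hcd
  have := Nat.le_findGreatest (P := Sep) (m := T.card + 1) (hbdd _ hS) hS
  rw [← hT] at this
  exact absurd this (Nat.not_succ_le_self _)

/-- Approximating a unit vector by a net point gives ‖ℓ‖ ≤ t + ‖ℓ‖/2, hence ‖ℓ‖ ≤ 2t. -/
theorem LinearMap.abs_le_of_half_net {F : Type*} [NormedAddCommGroup F] [NormedSpace ℝ F]
    [FiniteDimensional ℝ F] {T : Finset F}
    (hT : ∀ x : F, ‖x‖ ≤ 1 → ∃ c ∈ T, ‖x - c‖ ≤ 1 / 2) (ℓ : F →ₗ[ℝ] ℝ) {t : ℝ}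
    (h : ∀ c ∈ T, |ℓ c| ≤ t) (x : F) : |ℓ x| ≤ 2 * t * ‖x‖ := by
  set f := LinearMap.toContinuousLinearMap ℓ
  have hf : ∀ y, f y = ℓ y := fun y => rfl
  have ht : 0 ≤ t := by
    obtain ⟨c, hc, -⟩ := hT 0 (by simp)
    exact (abs_nonneg _).trans (h c hc)
  have key : ∀ y : F, ‖y‖ ≤ 1 → ‖f y‖ ≤ t + ‖f‖ / 2 := by
    intro y hy
    obtain ⟨c, hc, hyc⟩ := hT y hy
    have e : f y = f c + f (y - c) := by rw [← map_add]; congr 1; abel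
    rw [e]
    refine (norm_add_le _ _).trans (add_le_add (h c hc) ?_)
    calc ‖f (y - c)‖ ≤ ‖f‖ * ‖y - c‖ := f.le_opNorm _
      _ ≤ ‖f‖ * (1 / 2) := by gcongr
      _ = _ := by ring
  have hn : ‖f‖ ≤ t + ‖f‖ / 2 :=
    ContinuousLinearMap.opNorm_le_of_unit_norm (by positivity) fun y hy => key y hy.le
  calc |ℓ x| = ‖f x‖ := rfl
    _ ≤ ‖f‖ * ‖x‖ := f.le_opNorm x
    _ ≤ _ := by gcongr; linarith

theorem LinearMap.abs_le_of_half_net₂ {F : Type*} [NormedAddCommGroup F] [NormedSpace ℝ F]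
    [FiniteDimensional ℝ F] {T : Finset F}
    (hT : ∀ x : F, ‖x‖ ≤ 1 → ∃ c ∈ T, ‖x - c‖ ≤ 1 / 2) (β : F →ₗ[ℝ] F →ₗ[ℝ] ℝ) {t : ℝ}
    (h : ∀ c ∈ T, ∀ d ∈ T, |β c d| ≤ t) (x y : F) : |β x y| ≤ 4 * t * ‖x‖ * ‖y‖ := by
  have h1 : ∀ c ∈ T, |β.flip y c| ≤ 2 * t * ‖y‖ := fun c hc =>
    LinearMap.abs_le_of_half_net hT (β c) (h c hc) y
  have := LinearMap.abs_le_of_half_net hT (β.flip y) h1 x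
  rw [LinearMap.flip_apply] at this
  linarith

theorem measure_biUnion_finset_le_card_mul {Ω ι : Type*} [MeasurableSpace Ω] {μ : Measure Ω}
    (T : Finset ι) (A : ι → Set Ω) {k q : ℝ} (hk : (T.card : ℝ) ≤ k) (hk0 : 0 ≤ k)
    (h : ∀ c ∈ T, μ (A c) ≤ ENNReal.ofReal q) :
    μ (⋃ c ∈ T, A c) ≤ ENNReal.ofReal (k * q) := by
  calc μ (⋃ c ∈ T, A c) ≤ ∑ c ∈ T, μ (A c) := measure_biUnion_finset_le _ _
    _ ≤ ∑ _c ∈ T, ENNReal.ofReal q := Finset.sum_le_sum h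
    _ = T.card * ENNReal.ofReal q := by rw [Finset.sum_const, nsmul_eq_mul]
    _ ≤ ENNReal.ofReal k * ENNReal.ofReal q := by
        gcongr
        rw [← ENNReal.ofReal_natCast]
        exact ENNReal.ofReal_le_ofReal hk
    _ = _ := (ENNReal.ofReal_mul hk0).symm

section
variable {m : ℕ} {Ω : Type*} [MeasurableSpace Ω] {μ : Measure Ω}

local notation "E" => EuclideanSpace ℝ (Fin m)

theorem measure_exists_linear_gt_le (ℓ : Ω → E →ₗ[ℝ] ℝ) {t q : ℝ}
    (h : ∀ u : E, ‖u‖ ≤ 1 → μ {ω | t < |ℓ ω u|} ≤ ENNReal.ofReal q) :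
    μ {ω | ∃ x : E, 2 * t * ‖x‖ < |ℓ ω x|} ≤ ENNReal.ofReal (5 ^ m * q) := by
  obtain ⟨T, hTc, hT1, hT⟩ := exists_half_net E
  rw [finrank_euclideanSpace_fin] at hTc
  refine le_trans (measure_mono ?_) (measure_biUnion_finset_le_card_mul T
    (fun u => {ω | t < |ℓ ω u|}) (by exact_mod_cast hTc) (by positivity) fun c hc => h c (hT1 c hc))
  rintro ω ⟨x, hx⟩
  by_contra hcon
  simp only [Set.mem_iUnion, Set.mem_ofPred_eq, not_exists, not_lt] at hcon
  exact absurd (LinearMap.abs_le_of_half_net hT (ℓ ω) hcon x) hx.not_ge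

theorem measure_exists_bilinear_gt_le (β : Ω → E →ₗ[ℝ] E →ₗ[ℝ] ℝ) {t q : ℝ}
    (h : ∀ u w : E, ‖u‖ ≤ 1 → ‖w‖ ≤ 1 → μ {ω | t < |β ω u w|} ≤ ENNReal.ofReal q) :
    μ {ω | ∃ x y : E, 4 * t * ‖x‖ * ‖y‖ < |β ω x y|} ≤ ENNReal.ofReal (25 ^ m * q) := by
  obtain ⟨T, hTc, hT1, hT⟩ := exists_half_net E
  rw [finrank_euclideanSpace_fin] at hTc
  have hc2 : ((T ×ˢ T).card : ℝ) ≤ 25 ^ m := by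
    rw [Finset.card_product, show (25 : ℝ) = 5 * 5 by norm_num, mul_pow]
    exact_mod_cast Nat.mul_le_mul hTc hTc
  refine le_trans (measure_mono ?_) (measure_biUnion_finset_le_card_mul (T ×ˢ T)
    (fun p => {ω | t < |β ω p.1 p.2|}) hc2 (by positivity) fun c hc =>
      h c.1 c.2 (hT1 _ (Finset.mem_product.1 hc).1) (hT1 _ (Finset.mem_product.1 hc).2))
  rintro ω ⟨x, y, hx⟩
  by_contra hcon
  simp only [Set.mem_iUnion, Set.mem_ofPred_eq, not_exists, not_lt] at hcon
  exact absurd (LinearMap.abs_le_of_half_net₂ hT (β ω)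
    (fun c hc d hd => hcon (c, d) (Finset.mk_mem_product hc hd)) x y) hx.not_ge

end

/-! ### The exceptional event -/

section
variable {N m : ℕ}

local notation "E" => EuclideanSpace ℝ (Fin m)
local notation "γ" => stdGaussian (EuclideanSpace ℝ (Fin m))

/-- The linear form `x ↦ ∑ i, a i ⟪g i, x⟫`. -/
noncomputable def weightedSum (a : Fin N → ℝ) (g : Fin N → E) : E →ₗ[ℝ] ℝ where
  toFun x := ∑ i, a i * inner ℝ (g i) x
  map_add' x y := by simp [inner_add_right, mul_add, Finset.sum_add_distrib]
  map_smul' c x := by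
    simp only [inner_smul_right, smul_eq_mul, RingHom.id_apply, Finset.mul_sum]
    exact Finset.sum_congr rfl fun i _ => by ring

/-- The bilinear form `(x, y) ↦ ∑ i, a i ⟪g i, x⟫ ⟪g i, y⟫ - c ⟪x, y⟫`. -/
noncomputable def weightedGram (a : Fin N → ℝ) (g : Fin N → E) (c : ℝ) :
    E →ₗ[ℝ] E →ₗ[ℝ] ℝ :=
  LinearMap.mk₂ ℝ (fun x y => ∑ i, a i * (inner ℝ (g i) x * inner ℝ (g i) y) - c * inner ℝ x y)
    (fun x y z => by
      simp only [inner_add_right, inner_add_left, mul_add, add_mul, Finset.sum_add_distrib]; ring)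
    (fun c x y => by
      simp only [inner_smul_right, real_inner_smul_left, smul_eq_mul, mul_sub, Finset.mul_sum]
      congr 1
      · exact Finset.sum_congr rfl fun i _ => by ring
      · ring)
    (fun x y z => by
      simp only [inner_add_right, mul_add, Finset.sum_add_distrib]; ring)
    (fun c x y => by
      simp only [inner_smul_right, smul_eq_mul, mul_sub, Finset.mul_sum]
      congr 1
      · exact Finset.sum_congr rfl fun i _ => by ring
      · ring)

theorem weightedSum_apply (a : Fin N → ℝ) (g : Fin N → E) (x : E) :
    weightedSum a g x = ∑ i, a i * inner ℝ (g i) x := rfl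

theorem weightedGram_apply (a : Fin N → ℝ) (g : Fin N → E) (c : ℝ) (x y : E) :
    weightedGram a g c x y
      = ∑ i, a i * (inner ℝ (g i) x * inner ℝ (g i) y) - c * inner ℝ x y := rfl

/-- The level at which the centred squared norms are truncated. -/
noncomputable def truncLevel (m : ℕ) (L : ℝ) : ℝ :=
  2 * (√(100000 * (m + 1)) * √(4 * L) + 16 * (4 * L))

theorem truncLevel_nonneg {L : ℝ} (hL : 0 ≤ L) : 0 ≤ truncLevel m L := by
  unfold truncLevel; positivity

theorem abs_integral_truncDev_truncLevel_sub_le {L : ℝ} (hL : 0 ≤ L) (hN : 0 < N)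
    (hLN : Real.exp (-L) ≤ 1 / N) {u w : E} (hu : ‖u‖ ≤ 1) (hw : ‖w‖ ≤ 1) :
    |∫ g : E, truncDev (truncLevel m L) g * (inner ℝ g u * inner ℝ g w) ∂(γ) - 2 * inner ℝ u w|
      ≤ 50001 * √(2000000 * (m + 1)) / √N := by
  have hN' : (0 : ℝ) < N := by exact_mod_cast hN
  set S : ℝ := 2000000 * (m + 1) with hS
  have hS0 : 0 < S := by positivity
  have hq : (γ).real {g : E | truncLevel m L < |normSqDev g|} ≤ 2 / N := by
    have h := (subGamma_normSqDev (m := m)).measure_abs_gt_le (τ := 4 * L) (by positivity)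
      (by norm_num) (by positivity)
    have h2 : (γ).real {g : E | truncLevel m L < |normSqDev g|} ≤ 2 * Real.exp (-(4 * L)) :=
      ENNReal.toReal_le_of_le_ofReal (by positivity) h
    have h3 : Real.exp (-(4 * L)) ≤ Real.exp (-L) := Real.exp_le_exp.2 (by linarith)
    have h4 : 2 / (N : ℝ) = 2 * (1 / N) := by ring
    linarith
  -- With q = 2/N, this weight makes both error terms multiples of √S/√N, with coefficients 50000
  -- and 1.
  have ha : 0 < 1 / (√N * √S) := by positivity
  refine (abs_integral_truncDev_mul_inner_mul_inner_sub_le (truncLevel_nonneg hL) ha hq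
    hu hw).trans_eq ?_
  have e1 : √S ^ 2 = S := Real.sq_sqrt hS0.le
  have e2 : √(N : ℝ) ^ 2 = N := Real.sq_sqrt hN'.le
  have e3 : 50000 * (1 / (√(N : ℝ) * √S)) * S = 50000 * √S / √N := by
    nth_rewrite 2 [← e1]; field_simp
  have e4 : 2 / (N : ℝ) / (2 * (1 / (√N * √S))) = √S / √N := by
    nth_rewrite 1 [← e2]; field_simp
  rw [e3, e4]
  ring

/-- All random input is collected here: N truncation events and six deviation events, each of
probability at most 2e^{-4L} = 2(δ/N)⁴. The linear form with weights v_i times the truncated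
deviation appears twice, once for each of its sub-gamma bounds. -/
theorem exists_bad_event {Ω : Type*} [MeasurableSpace Ω] {P : Measure Ω} [IsProbabilityMeasure P]
    (hN : 3 ≤ N) {v : Fin N → ℝ} {d : ℝ} (hd0 : 0 ≤ d) (hd : ∀ i, |v i| ≤ d)
    {g : Fin N → Ω → E} (hg : ∀ i, HasLaw (g i) (γ) P) (hind : iIndepFun g P)
    {δ L : ℝ} (hδ0 : 0 < δ) (hδ1 : δ < 1) (hL : 0 < L) (hLδ : Real.exp (-L) = δ / N) :
    ∃ Bad : Set Ω, P Bad ≤ ENNReal.ofReal δ ∧ ∀ ω ∉ Bad,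
      (∀ i, |normSqDev (g i ω)| ≤ truncLevel m L) ∧
      |∑ i, v i ^ 2 * normSqDev (g i ω)| ≤
        2 * (√(100000 * (m + 1)) * √(∑ i, (v i ^ 2) ^ 2) * √(4 * L) + 16 * d ^ 2 * (4 * L)) ∧
      (∀ x, |weightedSum (fun i => v i ^ 3) (fun i => g i ω) x| ≤
        2 * (2 * (√1 * √(∑ i, (v i ^ 3) ^ 2) * √(4 * (m + L)) + 0 * d ^ 3 * (4 * (m + L))))
          * ‖x‖) ∧
      (∀ x, |weightedSum (fun i => v i * truncDev (truncLevel m L) (g i ω)) (fun i => g i ω) x| ≤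
        2 * (2 * (√(100000 * (2000000 * (m + 1))) * √(∑ i, v i ^ 2) * √(4 * (m + L))
          + 16 * truncLevel m L * d * (4 * (m + L)))) * ‖x‖) ∧
      (∀ x, |weightedSum (fun i => v i * truncDev (truncLevel m L) (g i ω)) (fun i => g i ω) x| ≤
        2 * (2 * (√(truncLevel m L ^ 2) * √(∑ i, v i ^ 2) * √(4 * (m + L))
          + 0 * d * (4 * (m + L)))) * ‖x‖) ∧
      (∀ x y, |weightedGram (fun i => v i ^ 2) (fun i => g i ω) (∑ i, v i ^ 2) x y| ≤
        4 * (2 * (√100000 * √(∑ i, (v i ^ 2) ^ 2) * √(4 * (m + L))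
          + 16 * d ^ 2 * (4 * (m + L)))) * ‖x‖ * ‖y‖) ∧
      (∀ x y, |weightedGram (fun i => truncDev (truncLevel m L) (g i ω)) (fun i => g i ω)
          (2 * N) x y| ≤
        4 * (2 * (√(100000 * (2000000 * (m + 1))) * √(N : ℝ) * √(4 * (m + L))
          + 16 * truncLevel m L * 1 * (4 * (m + L)))
          + N * (50001 * √(2000000 * (m + 1)) / √N)) * ‖x‖ * ‖y‖) := by
  have hN' : (3 : ℝ) ≤ N := by exact_mod_cast hN
  have hd2 : ∀ i, |v i ^ 2| ≤ d ^ 2 := fun i => by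
    rw [abs_pow]; exact pow_le_pow_left₀ (abs_nonneg _) (hd i) 2
  have hd3 : ∀ i, |v i ^ 3| ≤ d ^ 3 := fun i => by
    rw [abs_pow]; exact pow_le_pow_left₀ (abs_nonneg _) (hd i) 3
  have hLN : Real.exp (-L) ≤ 1 / N := by rw [hLδ]; gcongr
  have hexp1 : Real.exp (-(4 * L)) = (δ / N) ^ 4 := by
    rw [← hLδ, ← Real.exp_nat_mul]; congr 1; push_cast; ring
  -- Since 25 ≤ e⁴, the 4m in the deviation level absorbs the union bound over pairs of net points.
  have hexp2 : (25 : ℝ) ^ m * Real.exp (-(4 * (m + L))) ≤ Real.exp (-(4 * L)) := by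
    have h1 : (25 : ℝ) ≤ Real.exp 4 := by
      have h2 : Real.exp 4 = Real.exp 1 ^ 4 := by
        rw [← Real.exp_nat_mul]; congr 1; norm_num
      rw [h2]
      calc (25 : ℝ) ≤ 2.7 ^ 4 := by norm_num
        _ ≤ _ := by gcongr; linarith [Real.exp_one_gt_d9]
    calc (25 : ℝ) ^ m * Real.exp (-(4 * (m + L)))
        ≤ Real.exp 4 ^ m * Real.exp (-(4 * (m + L))) := by gcongr
      _ = _ := by rw [← Real.exp_nat_mul, ← Real.exp_add]; congr 1; ring
  have hexp3 : (5 : ℝ) ^ m * Real.exp (-(4 * (m + L))) ≤ Real.exp (-(4 * L)) :=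
    le_trans (by gcongr; norm_num) hexp2
  set K := truncLevel m L with hK
  have hK0 : 0 ≤ K := truncLevel_nonneg hL.le
  set p : ℝ := 2 * Real.exp (-(4 * L)) with hp
  have hτ : 0 ≤ 4 * (m + L) := by positivity
  have hscal : ∀ {q : ℝ} {A : Set Ω}, P A ≤ ENNReal.ofReal q → q ≤ p → P A ≤ ENNReal.ofReal p :=
    fun h hq => h.trans (ENNReal.ofReal_le_ofReal hq)
  have hT := measure_biUnion_finset_le_card_mul (μ := P) (Finset.univ : Finset (Fin N))
    (fun i => {ω | K < |normSqDev (g i ω)|}) (k := N) (q := p) (by simp) (by positivity)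
    (fun i _ => (subGamma_normSqDev.comp_hasLaw (hg i)).measure_abs_gt_le (by positivity)
      (by norm_num) (by positivity))
  have hA := SubGamma.measure_abs_sum_gt_le hg hind measurable_normSqDev subGamma_normSqDev
    (τ := 4 * L) (by positivity) (by norm_num) (by positivity) (by positivity) hd2
  have hB := hscal (measure_exists_linear_gt_le (μ := P)
    (fun ω => weightedSum (fun i => v i ^ 3) (fun i => g i ω)) fun u hu =>
      SubGamma.measure_abs_sum_gt_le hg hind (by fun_prop) (subGamma_inner_stdGaussian hu)
        one_pos le_rfl hτ (by positivity) hd3) (by linarith)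
  have hC := hscal (measure_exists_linear_gt_le (μ := P)
    (fun ω => weightedSum (fun i => v i * truncDev K (g i ω)) (fun i => g i ω)) fun u hu => by
      simp only [weightedSum_apply, mul_assoc (v _)]
      exact SubGamma.measure_abs_sum_gt_le hg hind ((measurable_truncDev K).mul (by fun_prop))
        (subGamma_truncDev_mul_inner hK0 hu) (by positivity) (by positivity) hτ hd0 hd)
      (by linarith)
  have hKp : 0 < K := by rw [hK, truncLevel]; positivity
  have hC' := hscal (measure_exists_linear_gt_le (μ := P)
    (fun ω => weightedSum (fun i => v i * truncDev K (g i ω)) (fun i => g i ω)) fun u hu => by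
      simp only [weightedSum_apply, mul_assoc (v _)]
      exact SubGamma.measure_abs_sum_gt_le hg hind ((measurable_truncDev K).mul (by fun_prop))
        (subGamma_truncDev_mul_inner_zero hK0 hu) (by positivity) le_rfl hτ hd0 hd)
      (by linarith)
  have hD := hscal (measure_exists_bilinear_gt_le (μ := P)
    (fun ω => weightedGram (fun i => v i ^ 2) (fun i => g i ω) (∑ i, v i ^ 2)) fun u w hu hw => by
      have := SubGamma.measure_abs_sum_gt_le hg hind (by fun_prop) (subGamma_inner_mul_inner hu hw)
        (by norm_num) (by norm_num) hτ (by positivity) hd2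
      simpa only [weightedGram_apply, mul_sub, Finset.sum_sub_distrib, Finset.sum_mul] using this)
      (by linarith)
  have hE := hscal (measure_exists_bilinear_gt_le (μ := P)
    (t := 2 * (√(100000 * (2000000 * (m + 1))) * √(N : ℝ) * √(4 * (m + L))
          + 16 * K * 1 * (4 * (m + L))) + N * (50001 * √(2000000 * (m + 1)) / √N))
    (fun ω => weightedGram (fun i => truncDev K (g i ω)) (fun i => g i ω) (2 * N))
    fun u w hu hw => by
      have := SubGamma.measure_abs_sum_gt_le hg hind
        (φ := fun g : E => truncDev K g * (inner ℝ g u * inner ℝ g w)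
          - ∫ g : E, truncDev K g * (inner ℝ g u * inner ℝ g w) ∂(γ))
        (((measurable_truncDev K).mul (by fun_prop)).sub_const _)
        (subGamma_truncDev_mul_inner_mul_inner hK0 hu hw) (by positivity) (by positivity) hτ
        (c := fun _ => 1) (d := 1) zero_le_one (by simp)
      rw [show ∑ _i : Fin N, (1 : ℝ) ^ 2 = N by simp] at this
      -- Bernstein centres each summand at its truncated mean e, whereas the Gram form is centred at
      -- 2⟪u, w⟫; the discrepancy N(e - 2⟪u, w⟫) is the bias term in the threshold.
      refine le_trans (measure_mono fun ω hω => ?_) this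
      have hb := abs_integral_truncDev_truncLevel_sub_le hL.le (by omega) hLN hu hw
      rw [Set.mem_ofPred_eq] at hω ⊢
      rw [← hK] at hb
      set e := ∫ g : E, truncDev K g * (inner ℝ g u * inner ℝ g w) ∂(γ)
      have h1 : weightedGram (fun i => truncDev K (g i ω)) (fun i => g i ω) (2 * N) u w
          = ∑ i, 1 * (truncDev K (g i ω) * (inner ℝ (g i ω) u * inner ℝ (g i ω) w) - e)
            + N * (e - 2 * inner ℝ u w) := by
        simp only [weightedGram_apply, one_mul, Finset.sum_sub_distrib, Finset.sum_const,
          Finset.card_univ, Fintype.card_fin, nsmul_eq_mul]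
        ring
      rw [h1] at hω
      have h2 := hω.trans_le (abs_add_le _ _)
      rw [abs_mul, Nat.abs_cast] at h2
      have h3 := mul_le_mul_of_nonneg_left hb (Nat.cast_nonneg (α := ℝ) N)
      exact lt_of_add_lt_add_right (h2.trans_le (add_le_add_right h3 _)))
      (by linarith)
  refine ⟨_, (measure_union_le _ _).trans (add_le_add hT ((measure_union_le _ _).trans
    (add_le_add hA ((measure_union_le _ _).trans (add_le_add hB ((measure_union_le _ _).trans
    (add_le_add hC ((measure_union_le _ _).trans (add_le_add hC' ((measure_union_le _ _).trans
    (add_le_add hD hE))))))))))) |>.trans ?_, fun ω hω => ?_⟩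
  · have hp0 : 0 ≤ p := by positivity
    rw [← hp]
    rw [← ENNReal.ofReal_add hp0 hp0, ← ENNReal.ofReal_add hp0 (by positivity),
      ← ENNReal.ofReal_add hp0 (by positivity), ← ENNReal.ofReal_add hp0 (by positivity),
      ← ENNReal.ofReal_add hp0 (by positivity),
      ← ENNReal.ofReal_add (by positivity) (by positivity)]
    refine ENNReal.ofReal_le_ofReal ?_
    have h1 : N * p + (p + (p + (p + (p + (p + p))))) = 2 * (N + 6) * (δ / N) ^ 4 := by
      rw [hp, hexp1]; ring
    rw [h1, div_pow, mul_div_assoc', div_le_iff₀ (by positivity)]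
    have h2 : δ ^ 4 ≤ δ := by
      calc δ ^ 4 = δ * δ ^ 3 := by ring
        _ ≤ δ * 1 := by gcongr; exact pow_le_one₀ hδ0.le hδ1.le
        _ = δ := mul_one δ
    have h3 : 2 * ((N : ℝ) + 6) ≤ N ^ 4 := by
      have h4 : (27 : ℝ) ≤ N ^ 3 := by
        calc (27 : ℝ) = 3 ^ 3 := by norm_num
          _ ≤ _ := by gcongr
      calc 2 * ((N : ℝ) + 6) ≤ 27 * N := by linarith
        _ ≤ N ^ 3 * N := by gcongr
        _ = _ := by ring
    calc 2 * ((N : ℝ) + 6) * δ ^ 4 ≤ N ^ 4 * δ := by gcongr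
      _ = _ := mul_comm _ _
  · simp only [Set.mem_union, Set.mem_iUnion, Set.mem_ofPred_eq, Finset.mem_univ, not_or,
      not_exists, not_lt, exists_prop, true_and] at hω
    exact hω

end

/-! ### Spectral norm and ℓ_p norms -/

theorem Matrix.l2_opNorm_le_of_dotProduct_le {n : ℕ} {A : Matrix (Fin n) (Fin n) ℝ} {B : ℝ}
    (hB : 0 ≤ B) (h : ∀ u w : EuclideanSpace ℝ (Fin n),
      |w.ofLp ⬝ᵥ A *ᵥ u.ofLp| ≤ B * ‖u‖ * ‖w‖) : ‖A‖ ≤ B := by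
  rw [Matrix.l2_opNorm_def]
  refine ContinuousLinearMap.opNorm_le_bound _ hB fun u => ?_
  set z : EuclideanSpace ℝ (Fin n) := WithLp.toLp 2 (A *ᵥ u.ofLp) with hz
  change ‖z‖ ≤ B * ‖u‖
  have h1 := h u z
  have h2 : z.ofLp ⬝ᵥ A *ᵥ u.ofLp = ‖z‖ * ‖z‖ := by
    rw [← sq, EuclideanSpace.real_norm_sq_eq]
    simp [hz, dotProduct, sq]
  rw [h2, abs_of_nonneg (by positivity)] at h1
  rcases (norm_nonneg z).eq_or_lt with h0 | h0
  · rw [← h0]; positivity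
  · exact le_of_mul_le_mul_right h1 h0

theorem vecNorm_pow {N : ℕ} (k : ℕ) (hk : 0 < k) (hk2 : Even k) (v : Fin N → ℝ) :
    vecNorm (k : ℝ≥0∞) v ^ k = ∑ i, v i ^ k := by
  have hk' : (0 : ℝ) < k := by exact_mod_cast hk
  rw [vecNorm, PiLp.norm_eq_sum (by simpa using hk)]
  simp only [ENNReal.toReal_natCast, Real.rpow_natCast, Real.norm_eq_abs, hk2.pow_abs]
  rw [← Real.rpow_natCast, ← Real.rpow_mul (Finset.sum_nonneg fun i _ => hk2.pow_nonneg _),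
    one_div_mul_cancel hk'.ne', Real.rpow_one]

theorem vecNorm_nonneg {N : ℕ} (p : ℝ≥0∞) [Fact (1 ≤ p)] (v : Fin N → ℝ) : 0 ≤ vecNorm p v :=
  norm_nonneg _

theorem abs_le_vecNorm_top {N : ℕ} (v : Fin N → ℝ) (i : Fin N) : |v i| ≤ vecNorm ∞ v := by
  rw [vecNorm, PiLp.norm_toLp]
  exact norm_le_pi_norm v i

/-! ### Block expansion of the matrix -/

section
variable {N m : ℕ}

local notation "E" => EuclideanSpace ℝ (Fin m)

/-- The vector of all coordinates but the first. -/
noncomputable def tailVec (u : EuclideanSpace ℝ (Fin (m + 1))) : E := WithLp.toLp 2 (Fin.tail u.ofLp)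

theorem norm_sq_eq_head_add_tail (u : EuclideanSpace ℝ (Fin (m + 1))) :
    ‖u‖ ^ 2 = u 0 ^ 2 + ‖tailVec u‖ ^ 2 := by
  simp [EuclideanSpace.real_norm_sq_eq, Fin.sum_univ_succ, tailVec, Fin.tail]

theorem abs_head_le_norm (u : EuclideanSpace ℝ (Fin (m + 1))) : |u 0| ≤ ‖u‖ := by
  refine abs_le_of_sq_le_sq ?_ (norm_nonneg u)
  rw [norm_sq_eq_head_add_tail]
  nlinarith [sq_nonneg ‖tailVec u‖]

theorem norm_tailVec_le (u : EuclideanSpace ℝ (Fin (m + 1))) : ‖tailVec u‖ ≤ ‖u‖ := by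
  refine le_of_sq_le_sq ?_ (norm_nonneg u)
  rw [norm_sq_eq_head_add_tail]
  nlinarith [sq_nonneg (u 0)]

theorem dotProduct_eq_head_add_tail (u w : EuclideanSpace ℝ (Fin (m + 1))) :
    w.ofLp ⬝ᵥ u.ofLp = w 0 * u 0 + inner ℝ (tailVec u) (tailVec w) := by
  simp [dotProduct, Fin.sum_univ_succ, tailVec, Fin.tail, PiLp.inner_apply]

theorem plantedRow_dotProduct (x : ℝ) (b : E) (u : EuclideanSpace ℝ (Fin (m + 1))) :
    (plantedRow x b).ofLp ⬝ᵥ u.ofLp = x * u 0 + inner ℝ b (tailVec u) := by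
  simp only [plantedRow, dotProduct, Fin.sum_univ_succ, Fin.cons_zero, Fin.cons_succ, tailVec,
    Fin.tail, PiLp.inner_apply, RCLike.inner_apply, conj_trivial]
  congr 1
  exact Finset.sum_congr rfl fun i _ => mul_comm _ _

theorem norm_plantedRow_sq (x : ℝ) (b : E) : ‖plantedRow x b‖ ^ 2 = x ^ 2 + ‖b‖ ^ 2 := by
  simp [EuclideanSpace.real_norm_sq_eq, plantedRow, Fin.sum_univ_succ]

/-- Each row contributes (v_i² + W_i/N) times a product of two affine expressions in g_i, where W_i
= ‖g_i‖² - m. Multiplying out, the Gram forms are recentred at ∑ v_i² and 2N; the recentring terms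
and the identity part of -3/N add up to the last summand. -/
theorem dotProduct_fourthMomentMatrix_sub (hN : 0 < N) (v : Fin N → ℝ) (b g : Fin N → E)
    (hg : ∀ i, g i = √(N : ℝ) • b i) (c : ℝ) (u w : EuclideanSpace ℝ (Fin (m + 1))) :
    w.ofLp ⬝ᵥ (fourthMomentMatrix (fun i => plantedRow (v i) (b i))
        - (c - 3 / (N : ℝ)) • firstProj m) *ᵥ u.ofLp
      = (∑ i, v i ^ 4 - c) * (w 0 * u 0) + (∑ i, v i ^ 2 * normSqDev (g i)) / N * (w 0 * u 0)
        + (weightedSum (fun i => v i ^ 3) g (tailVec u) / √N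
          + weightedSum (fun i => v i * normSqDev (g i)) g (tailVec u) / (N * √N)) * w 0
        + (weightedSum (fun i => v i ^ 3) g (tailVec w) / √N
          + weightedSum (fun i => v i * normSqDev (g i)) g (tailVec w) / (N * √N)) * u 0
        + weightedGram (fun i => v i ^ 2) g (∑ i, v i ^ 2) (tailVec u) (tailVec w) / N
        + weightedGram (fun i => normSqDev (g i)) g (2 * N) (tailVec u) (tailVec w) / N ^ 2
        + (∑ i, v i ^ 2 - 1) / N * inner ℝ (tailVec u) (tailVec w) := by
  have hN' : (0 : ℝ) < N := by exact_mod_cast hN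
  have hs : 0 < √(N : ℝ) := Real.sqrt_pos.2 hN'
  have hss : √(N : ℝ) ^ 2 = N := Real.sq_sqrt hN'.le
  set p := tailVec u
  set q := tailVec w
  have hbi : ∀ i (x : E), inner ℝ (b i) x = inner ℝ (g i) x / √N := by
    intro i x
    rw [hg, real_inner_smul_left]
    field_simp
  have hbn : ∀ i, ‖b i‖ ^ 2 - m / N = normSqDev (g i) / N := by
    intro i
    rw [normSqDev, hg, norm_smul, mul_pow, Real.norm_eq_abs, sq_abs, hss]
    field_simp
  have hcoef : ∀ i, ‖plantedRow (v i) (b i)‖ ^ 2 - (((m + 1 : ℕ) : ℝ) - 1) / N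
      = v i ^ 2 + normSqDev (g i) / N := by
    intro i
    rw [norm_plantedRow_sq, ← hbn]; push_cast; ring
  have hfirst : w.ofLp ⬝ᵥ firstProj m *ᵥ u.ofLp = w 0 * u 0 := by
    rw [firstProj, Matrix.vecMulVec_mulVec]
    simp [mul_comm]
  have hrow : ∀ i, w.ofLp ⬝ᵥ (Matrix.vecMulVec (plantedRow (v i) (b i)).ofLp
      (plantedRow (v i) (b i)).ofLp) *ᵥ u.ofLp
      = (v i * w 0 + inner ℝ (g i) q / √N) * (v i * u 0 + inner ℝ (g i) p / √N) := by
    intro i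
    rw [Matrix.vecMulVec_mulVec, ← hbi, ← hbi, ← plantedRow_dotProduct, ← plantedRow_dotProduct]
    simp [dotProduct_comm, mul_comm]
  rw [fourthMomentMatrix, Matrix.sub_mulVec, Matrix.sub_mulVec, dotProduct_sub, dotProduct_sub,
    Matrix.smul_mulVec, Matrix.smul_mulVec, Matrix.one_mulVec, dotProduct_smul, dotProduct_smul,
    hfirst, dotProduct_eq_head_add_tail u w, Matrix.sum_mulVec, dotProduct_sum]
  simp only [Matrix.smul_mulVec, dotProduct_smul, hrow, hcoef, smul_eq_mul, weightedSum_apply,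
    weightedGram_apply]
  have expand : ∀ i, (v i ^ 2 + normSqDev (g i) / N) *
      ((v i * w 0 + inner ℝ (g i) q / √N) * (v i * u 0 + inner ℝ (g i) p / √N))
      = v i ^ 4 * (w 0 * u 0) + v i ^ 2 * normSqDev (g i) * (w 0 * u 0 / N)
        + v i ^ 3 * inner ℝ (g i) p * (w 0 / √N)
        + v i * normSqDev (g i) * inner ℝ (g i) p * (w 0 / (N * √N))
        + v i ^ 3 * inner ℝ (g i) q * (u 0 / √N)
        + v i * normSqDev (g i) * inner ℝ (g i) q * (u 0 / (N * √N))
        + v i ^ 2 * (inner ℝ (g i) p * inner ℝ (g i) q) * (1 / N)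
        + normSqDev (g i) * (inner ℝ (g i) p * inner ℝ (g i) q) * (1 / N ^ 2) := by
    intro i
    have e : (inner ℝ (g i) q / √(N : ℝ)) * (inner ℝ (g i) p / √N)
        = inner ℝ (g i) p * inner ℝ (g i) q * (1 / N) := by
      rw [div_mul_div_comm, ← sq, hss]; ring
    calc _ = (v i ^ 2 + normSqDev (g i) / N) * (v i * w 0 * (v i * u 0)
          + v i * w 0 * (inner ℝ (g i) p / √N) + v i * u 0 * (inner ℝ (g i) q / √N)
          + (inner ℝ (g i) q / √(N : ℝ)) * (inner ℝ (g i) p / √N)) := by ring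
      _ = _ := by rw [e]; field_simp; ring
  simp only [expand, Finset.sum_add_distrib, ← Finset.sum_mul]
  field_simp
  ring

theorem norm_fourthMomentMatrix_sub_le (hN : 0 < N) (v : Fin N → ℝ) (b g : Fin N → E)
    (hg : ∀ i, g i = √(N : ℝ) • b i) {tA tB tC tD tE : ℝ}
    (hA : |∑ i, v i ^ 2 * normSqDev (g i)| ≤ tA)
    (hB0 : 0 ≤ tB) (hB : ∀ x, |weightedSum (fun i => v i ^ 3) g x| ≤ tB * ‖x‖)
    (hC0 : 0 ≤ tC) (hC : ∀ x, |weightedSum (fun i => v i * normSqDev (g i)) g x| ≤ tC * ‖x‖)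
    (hD0 : 0 ≤ tD)
    (hD : ∀ x y, |weightedGram (fun i => v i ^ 2) g (∑ i, v i ^ 2) x y| ≤ tD * ‖x‖ * ‖y‖)
    (hE0 : 0 ≤ tE)
    (hE : ∀ x y, |weightedGram (fun i => normSqDev (g i)) g (2 * N) x y| ≤ tE * ‖x‖ * ‖y‖) :
    ‖fourthMomentMatrix (fun i => plantedRow (v i) (b i))
        - (vecNorm 4 v ^ 4 - 3 / (N : ℝ)) • firstProj m‖
      ≤ tA / N + 2 * (tB / √N + tC / (N * √N)) + tD / N + tE / N ^ 2
        + |vecNorm 2 v ^ 2 - 1| / N := by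
  have hA0 : 0 ≤ tA := (abs_nonneg _).trans hA
  have h4 : vecNorm 4 v ^ 4 = ∑ i, v i ^ 4 := by
    have := vecNorm_pow 4 (by norm_num) (by decide) v; exact_mod_cast this
  have h2 : vecNorm 2 v ^ 2 = ∑ i, v i ^ 2 := by
    have := vecNorm_pow 2 (by norm_num) (by decide) v; exact_mod_cast this
  refine Matrix.l2_opNorm_le_of_dotProduct_le (by positivity) fun u w => ?_
  rw [dotProduct_fourthMomentMatrix_sub hN v b g hg, h4, sub_self, zero_mul, zero_add, h2]
  have hu0 := abs_head_le_norm u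
  have hw0 := abs_head_le_norm w
  have hu := norm_tailVec_le u
  have hw := norm_tailVec_le w
  set p := tailVec u
  set q := tailVec w
  have b1 : |(∑ i, v i ^ 2 * normSqDev (g i)) / N * (w 0 * u 0)| ≤ tA / N * (‖w‖ * ‖u‖) := by
    rw [abs_mul, abs_div, abs_mul, Nat.abs_cast]
    gcongr
  have bs : ∀ (x y : EuclideanSpace ℝ (Fin (m + 1))),
      |(weightedSum (fun i => v i ^ 3) g (tailVec x) / √N
          + weightedSum (fun i => v i * normSqDev (g i)) g (tailVec x) / (N * √N)) * y 0|
      ≤ (tB / √N + tC / (N * √N)) * ‖x‖ * ‖y‖ := by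
    intro x y
    rw [abs_mul]
    refine mul_le_mul ?_ (abs_head_le_norm y) (abs_nonneg _) (by positivity)
    refine (abs_add_le _ _).trans ?_
    rw [abs_div, abs_div, abs_of_nonneg (Real.sqrt_nonneg (N : ℝ)),
      abs_of_nonneg (show 0 ≤ (N : ℝ) * √N by positivity), add_mul, div_mul_eq_mul_div,
      div_mul_eq_mul_div]
    have hx := norm_tailVec_le x
    gcongr
    · exact (hB _).trans (by gcongr)
    · exact (hC _).trans (by gcongr)
  have b4 : |weightedGram (fun i => v i ^ 2) g (∑ i, v i ^ 2) p q / N| ≤ tD / N * (‖w‖ * ‖u‖) := by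
    rw [abs_div, Nat.abs_cast, div_mul_eq_mul_div]
    gcongr
    refine (hD p q).trans ?_
    calc tD * ‖p‖ * ‖q‖ ≤ tD * ‖u‖ * ‖w‖ := by gcongr
      _ = _ := by ring
  have b5 : |weightedGram (fun i => normSqDev (g i)) g (2 * N) p q / N ^ 2|
      ≤ tE / N ^ 2 * (‖w‖ * ‖u‖) := by
    rw [abs_div, abs_of_nonneg (show 0 ≤ (N : ℝ) ^ 2 by positivity), div_mul_eq_mul_div]
    gcongr
    refine (hE p q).trans ?_
    calc tE * ‖p‖ * ‖q‖ ≤ tE * ‖u‖ * ‖w‖ := by gcongr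
      _ = _ := by ring
  have b6 : |(∑ i, v i ^ 2 - 1) / N * inner ℝ p q| ≤ |∑ i, v i ^ 2 - 1| / N * (‖w‖ * ‖u‖) := by
    rw [abs_mul, abs_div, Nat.abs_cast]
    gcongr
    refine (abs_real_inner_le_norm p q).trans ?_
    rw [mul_comm ‖w‖]
    gcongr
  have b2 := bs u w
  have b3 := bs w u
  refine (abs_add_le _ _).trans ((add_le_add ((abs_add_le _ _).trans (add_le_add
    ((abs_add_le _ _).trans (add_le_add ((abs_add_le _ _).trans (add_le_add
    ((abs_add_le _ _).trans (add_le_add b1 b2)) b3)) b4)) b5)) b6).trans_eq ?_)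
  ring

end

/-! ### Comparison of the deviations with η -/

theorem sqrt_sum_sq_sq_eq_vecNorm_four_sq {N : ℕ} (v : Fin N → ℝ) :
    √(∑ i, (v i ^ 2) ^ 2) = vecNorm 4 v ^ 2 := by
  have h := vecNorm_pow 4 (by norm_num) (by decide) v
  have h' : vecNorm 4 v ^ 4 = ∑ i, v i ^ 4 := by exact_mod_cast h
  rw [show ∑ i, (v i ^ 2) ^ 2 = (vecNorm 4 v ^ 2) ^ 2 by
    rw [← pow_mul, h']; exact Finset.sum_congr rfl fun i _ => by ring]
  exact Real.sqrt_sq (sq_nonneg _)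

theorem sqrt_sum_sq_eq_vecNorm_two {N : ℕ} (v : Fin N → ℝ) : √(∑ i, v i ^ 2) = vecNorm 2 v := by
  have h := vecNorm_pow 2 (by norm_num) (by decide) v
  have h' : vecNorm 2 v ^ 2 = ∑ i, v i ^ 2 := by exact_mod_cast h
  rw [← h']
  exact Real.sqrt_sq (vecNorm_nonneg 2 v)

theorem sqrt_sum_cube_sq_eq_vecNorm_six_cube {N : ℕ} (v : Fin N → ℝ) :
    √(∑ i, (v i ^ 3) ^ 2) = vecNorm 6 v ^ 3 := by
  have h := vecNorm_pow 6 (by norm_num) (by decide) v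
  have h' : vecNorm 6 v ^ 6 = ∑ i, v i ^ 6 := by exact_mod_cast h
  have : Fact ((1 : ℝ≥0∞) ≤ 6) := ⟨by norm_num⟩
  rw [show ∑ i, (v i ^ 3) ^ 2 = (vecNorm 6 v ^ 3) ^ 2 by
    rw [← pow_mul, h']; exact Finset.sum_congr rfl fun i _ => by ring]
  exact Real.sqrt_sq (pow_nonneg (vecNorm_nonneg 6 v) 3)

/-- In this and the next lemmas r = √n, l = √L, s = √N. For l ≤ r the product is of order r³l, below
the (nL)^{3/2} term; for r ≤ l it is of order l⁴, and l³ ≤ s reduces it to l·s. -/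
theorem truncLevel_mul_le {r l s K T : ℝ} (hr : 1 ≤ r) (hl : 1 ≤ l) (hls : l ^ 3 ≤ s)
    (hT0 : 0 ≤ T) (hK : K ≤ 1600 * (r * l + l ^ 2)) (hT : T ≤ 4 * (r ^ 2 + l ^ 2)) :
    K * T ≤ 25600 * (r ^ 3 * l ^ 3 + r ^ 2 * l * s) := by
  have hs : 0 ≤ s := le_trans (by positivity) hls
  refine (mul_le_mul hK hT hT0 (by positivity)).trans ?_
  rcases le_total l r with h | h
  · have h1 : r * l + l ^ 2 ≤ 2 * (r * l) := by nlinarith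
    have h2 : r ^ 2 + l ^ 2 ≤ 2 * r ^ 2 := by nlinarith
    have h3 : r ^ 3 * l ≤ r ^ 3 * l ^ 3 := by
      gcongr; exact le_self_pow₀ hl (by norm_num)
    have h4 : 0 ≤ r ^ 2 * l * s := by positivity
    calc 1600 * (r * l + l ^ 2) * (4 * (r ^ 2 + l ^ 2))
        ≤ 1600 * (2 * (r * l)) * (4 * (2 * r ^ 2)) := by gcongr
      _ = 25600 * (r ^ 3 * l) := by ring
      _ ≤ _ := by linarith
  · have h1 : r * l + l ^ 2 ≤ 2 * l ^ 2 := by nlinarith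
    have h2 : r ^ 2 + l ^ 2 ≤ 2 * l ^ 2 := by nlinarith
    have h3 : l ^ 3 * l ≤ r ^ 2 * l * s := by
      calc l ^ 3 * l ≤ s * l := by gcongr
        _ = 1 * (l * s) := by ring
        _ ≤ r ^ 2 * (l * s) := by gcongr; exact one_le_pow₀ hr
        _ = _ := by ring
    have h4 : 0 ≤ r ^ 3 * l ^ 3 := by positivity
    calc 1600 * (r * l + l ^ 2) * (4 * (r ^ 2 + l ^ 2))
        ≤ 1600 * (2 * l ^ 2) * (4 * (2 * l ^ 2)) := by gcongr
      _ = 25600 * (l ^ 3 * l) := by ring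
      _ ≤ _ := by linarith

/-- For l ≤ r the sub-Gaussian bound `h2` applies, K being of order rl and t of order r. For r ≤ l
that bound would give a·l³, so `h1` is used, at the price of the term d·l⁴. -/
theorem min_cross_term_le {r l K T t a d tC : ℝ} (hr : 1 ≤ r) (hl : 1 ≤ l)
    (ht0 : 0 ≤ t) (hT0 : 0 ≤ T) (ha : 0 ≤ a) (hd : 0 ≤ d)
    (hK : K ≤ 1600 * (r * l + l ^ 2)) (hT : T ≤ 4 * (r ^ 2 + l ^ 2)) (ht : t ≤ 2 * (r + l))
    (h1 : tC ≤ 4 * (500000 * r * a * t + 16 * K * d * T)) (h2 : tC ≤ 4 * (K * a * t)) :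
    tC ≤ 8000000 * (a * (r ^ 2 * l)) + 1638400 * (d * l ^ 4) := by
  have har : 0 ≤ a * (r ^ 2 * l) := by positivity
  have hdl : 0 ≤ d * l ^ 4 := by positivity
  rcases le_total l r with h | h
  · have e1 : r * l + l ^ 2 ≤ 2 * (r * l) := by nlinarith
    have e2 : K * a * t ≤ 1600 * (2 * (r * l)) * a * (2 * (2 * r)) := by
      gcongr
      · linarith
      · linarith
    have e3 : 1600 * (2 * (r * l)) * a * (2 * (2 * r)) = 12800 * (a * (r ^ 2 * l)) := by ring
    linarith
  · have e1 : r * l + l ^ 2 ≤ 2 * l ^ 2 := by nlinarith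
    have e2 : r ^ 2 + l ^ 2 ≤ 2 * l ^ 2 := by nlinarith
    have e3 : r + l ≤ 2 * (r * l) := by nlinarith
    have e4 : 16 * K * d * T ≤ 16 * (1600 * (2 * l ^ 2)) * d * (4 * (2 * l ^ 2)) := by
      gcongr
      · linarith
      · linarith
    have e5 : 500000 * r * a * t ≤ 500000 * r * a * (2 * (2 * (r * l))) := by
      gcongr; linarith
    have e6 : 16 * (1600 * (2 * l ^ 2)) * d * (4 * (2 * l ^ 2)) = 409600 * (d * l ^ 4) := by ring
    have e7 : 500000 * r * a * (2 * (2 * (r * l))) = 2000000 * (a * (r ^ 2 * l)) := by ring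
    linarith

/-- AM-GM in the form (ds)² - ds + 1 ≥ 0 splits the leftover d·l⁴ into a part quadratic in d, which
belongs to the ‖v‖_∞² term, and l⁴/s⁴, which l³ ≤ s moves into the +1 of ‖v‖ + 1. -/
theorem cross_term_le {r l s d : ℝ} (hr : 1 ≤ r) (hl : 1 ≤ l) (hls : l ^ 3 ≤ s) :
    d * l ^ 4 / s ^ 3 ≤ d ^ 2 * (r ^ 2 * l ^ 2 + l ^ 4) / s ^ 2 + r ^ 2 * l / s ^ 3 := by
  have hs : 0 < s := lt_of_lt_of_le (by positivity) hls
  have h0 : d * l ^ 4 / s ^ 3 ≤ d ^ 2 * l ^ 4 / s ^ 2 + l ^ 4 / s ^ 4 := by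
    have e : d ^ 2 * l ^ 4 / s ^ 2 + l ^ 4 / s ^ 4 - d * l ^ 4 / s ^ 3
        = l ^ 4 / s ^ 4 * (d ^ 2 * s ^ 2 - d * s + 1) := by field_simp; ring
    have : 0 ≤ l ^ 4 / s ^ 4 * (d ^ 2 * s ^ 2 - d * s + 1) :=
      mul_nonneg (by positivity) (by nlinarith [sq_nonneg (d * s - 1), sq_nonneg (d * s)])
    linarith
  have h1 : d ^ 2 * l ^ 4 / s ^ 2 ≤ d ^ 2 * (r ^ 2 * l ^ 2 + l ^ 4) / s ^ 2 := by
    gcongr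
    have : 0 ≤ r ^ 2 * l ^ 2 := by positivity
    linarith
  have h2 : l ^ 4 / s ^ 4 ≤ r ^ 2 * l / s ^ 3 := by
    rw [div_le_div_iff₀ (by positivity) (by positivity)]
    calc l ^ 4 * s ^ 3 = l ^ 3 * (l * s ^ 3) := by ring
      _ ≤ s * (l * s ^ 3) := by gcongr
      _ = 1 * (l * s ^ 4) := by ring
      _ ≤ r ^ 2 * (l * s ^ 4) := by gcongr; exact one_le_pow₀ hr
      _ = _ := by ring
  linarith

theorem error_terms_le {r l s K T t a A4 A6 d tA tB tC tD tE : ℝ} (hr : 1 ≤ r) (hl : 1 ≤ l)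
    (hls : l ^ 3 ≤ s) (ht0 : 0 ≤ t) (hT0 : 0 ≤ T) (ha : 0 ≤ a) (hA4 : 0 ≤ A4) (hA6 : 0 ≤ A6)
    (hd : 0 ≤ d) (hK : K ≤ 1600 * (r * l + l ^ 2)) (hT : T ≤ 4 * (r ^ 2 + l ^ 2))
    (ht : t ≤ 2 * (r + l)) (hA : tA ≤ 2 * (400 * r * A4 * (2 * l) + 64 * d ^ 2 * l ^ 2))
    (hB : tB ≤ 4 * (A6 * t))
    (hC1 : tC ≤ 4 * (500000 * r * a * t + 16 * K * d * T)) (hC2 : tC ≤ 4 * (K * a * t))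
    (hD : tD ≤ 8 * (400 * A4 * t + 16 * d ^ 2 * T))
    (hE : tE ≤ 4 * (2 * (500000 * r * s * t + 16 * K * T) + s * (50001 * (2000 * r)))) :
    tA / s ^ 2 + 2 * (tB / s + tC / (s ^ 2 * s)) + tD / s ^ 2 + tE / (s ^ 2) ^ 2
      ≤ 1000000000 * ((a + 1) * (r ^ 2 * l / s ^ 3) + A4 * (r * l / s ^ 2)
        + A6 * ((r + l) / s) + d ^ 2 * ((r ^ 2 * l ^ 2 + l ^ 4) / s ^ 2)
        + (r * l) ^ 3 / s ^ 4) := by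
  have hs : 0 < s := lt_of_lt_of_le (by positivity) hls
  have hrl : r + l ≤ 2 * (r * l) := by nlinarith
  have htrl : t ≤ 4 * (r * l) := by linarith
  have hl4 : 0 ≤ l ^ 4 := by positivity
  have hTrl : T ≤ 8 * (r ^ 2 * l ^ 2 + l ^ 4) := by
    have h1 : r ^ 2 ≤ r ^ 2 * l ^ 2 := le_mul_of_one_le_right (by positivity) (one_le_pow₀ hl)
    have h2 : l ^ 2 ≤ l ^ 4 := pow_le_pow_right₀ hl (by norm_num)
    linarith
  set p1 := r ^ 2 * l / s ^ 3
  set p2 := A4 * (r * l / s ^ 2) with hp2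
  set p3 := A6 * ((r + l) / s) with hp3
  set p4 := d ^ 2 * ((r ^ 2 * l ^ 2 + l ^ 4) / s ^ 2) with hp4
  set p5 := (r * l) ^ 3 / s ^ 4 with hp5
  have n1 : 0 ≤ p1 := by positivity
  have n1a : 0 ≤ a * p1 := by positivity
  have n2 : 0 ≤ p2 := by positivity
  have n3 : 0 ≤ p3 := by positivity
  have n4 : 0 ≤ p4 := by positivity
  have n5 : 0 ≤ p5 := by positivity
  have bA : tA / s ^ 2 ≤ 1600 * p2 + 128 * p4 := by
    have h1 : l ^ 2 ≤ r ^ 2 * l ^ 2 + l ^ 4 := by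
      have : l ^ 2 ≤ l ^ 4 := pow_le_pow_right₀ hl (by norm_num)
      have : 0 ≤ r ^ 2 * l ^ 2 := by positivity
      linarith
    calc tA / s ^ 2 ≤ 2 * (400 * r * A4 * (2 * l) + 64 * d ^ 2 * (r ^ 2 * l ^ 2 + l ^ 4)) / s ^ 2 := by
          gcongr; exact hA.trans (by gcongr)
      _ = _ := by rw [hp2, hp4]; ring
  have bB : tB / s ≤ 8 * p3 := by
    calc tB / s ≤ 4 * (A6 * (2 * (r + l))) / s := by gcongr; exact hB.trans (by gcongr)
      _ = _ := by rw [hp3]; ring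
  have bC : tC / (s ^ 2 * s) ≤ 8000000 * (a * p1) + 1638400 * (p4 + p1) := by
    have h1 := min_cross_term_le hr hl ht0 hT0 ha hd hK hT ht hC1 hC2
    have h2 := cross_term_le (d := d) hr hl hls
    calc tC / (s ^ 2 * s) ≤ (8000000 * (a * (r ^ 2 * l)) + 1638400 * (d * l ^ 4)) / (s ^ 2 * s) := by
          gcongr
      _ = 8000000 * (a * (r ^ 2 * l / s ^ 3)) + 1638400 * (d * l ^ 4 / s ^ 3) := by ring
      _ ≤ 8000000 * (a * (r ^ 2 * l / s ^ 3)) + 1638400 *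
          (d ^ 2 * (r ^ 2 * l ^ 2 + l ^ 4) / s ^ 2 + r ^ 2 * l / s ^ 3) := by gcongr
      _ = _ := by rw [mul_div_assoc (d ^ 2)]
  have bD : tD / s ^ 2 ≤ 12800 * p2 + 1024 * p4 := by
    calc tD / s ^ 2 ≤ 8 * (400 * A4 * (4 * (r * l))
          + 16 * d ^ 2 * (8 * (r ^ 2 * l ^ 2 + l ^ 4))) / s ^ 2 := by
          gcongr; exact hD.trans (by gcongr)
      _ = _ := by rw [hp2, hp4]; ring
  have bE : tE / (s ^ 2) ^ 2 ≤ 500000000 * p1 + 4000000 * p5 := by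
    have h1 := truncLevel_mul_le hr hl hls hT0 hK hT
    have h2 : 500000 * r * s * t ≤ 2000000 * (r ^ 2 * l * s) := by
      calc 500000 * r * s * t ≤ 500000 * r * s * (4 * (r * l)) := by gcongr
        _ = _ := by ring
    have h3 : s * (50001 * (2000 * r)) ≤ 100002000 * (r ^ 2 * l * s) := by
      have h4 : r ≤ r ^ 2 * l := by
        calc r ≤ r ^ 2 := le_self_pow₀ hr (by norm_num)
          _ ≤ r ^ 2 * l := le_mul_of_one_le_right (by positivity) hl
      calc s * (50001 * (2000 * r)) ≤ s * (50001 * (2000 * (r ^ 2 * l))) := by gcongr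
        _ = _ := by ring
    have h5 : 0 ≤ r ^ 2 * l * s := by positivity
    have h6 : 0 ≤ r ^ 3 * l ^ 3 := by positivity
    calc tE / (s ^ 2) ^ 2 ≤ (500000000 * (r ^ 2 * l * s) + 4000000 * (r ^ 3 * l ^ 3)) / (s ^ 2) ^ 2 := by
          gcongr; linarith
      _ = 500000000 * (r ^ 2 * l / s ^ 3) + 4000000 * ((r * l) ^ 3 / s ^ 4) := by field_simp
  have : (a + 1) * p1 = a * p1 + p1 := by ring
  rw [this]
  linarith

/-! ### Assembly -/

/-- Here `n = m + 1`, so that `b i` takes values in `ℝ^(n-1) = ℝ^m`; matrices carry the spectral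
norm. -/
theorem proposition4p1 :
    ∃ C : ℝ, 0 < C ∧
      ∀ (N m : ℕ) (_ : 3 ≤ N) (_ : m + 1 ≤ N) (v : Fin N → ℝ)
        (Ω : Type*) [MeasurableSpace Ω] (P : Measure Ω) [IsProbabilityMeasure P]
        (b : Fin N → Ω → EuclideanSpace ℝ (Fin m))
        (_ : ∀ i, HasLaw (b i)
          (multivariateGaussian 0 ((1 / (N : ℝ)) • (1 : Matrix (Fin m) (Fin m) ℝ))) P)
        (_ : iIndepFun b P)
        (δ : ℝ) (_ : 0 < δ) (_ : δ < 1) (_ : Real.log (N / δ) ^ 7 ≤ (N : ℝ)),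
        ENNReal.ofReal (1 - δ) ≤
          P {ω | ‖fourthMomentMatrix (fun i => plantedRow (v i) (b i ω))
                - (vecNorm 4 v ^ 4 - 3 / (N : ℝ)) • firstProj m‖
              ≤ etaBound C N (m + 1) v δ} := by
  refine ⟨1000000000, by norm_num, ?_⟩
  intro N m hN _ v Ω _ P _ b hb hbind δ hδ0 hδ1 hLN
  have hN3 : (3 : ℝ) ≤ N := by exact_mod_cast hN
  have hN0 : 0 < N := by omega
  have hN0' : (0 : ℝ) < N := by linarith
  set L := Real.log (N / δ) with hL
  -- N/δ ≥ N ≥ 3 > e.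
  have hL1 : 1 ≤ L := by
    rw [hL, Real.le_log_iff_exp_le (by positivity)]
    have h1 : (N : ℝ) ≤ N / δ := by
      rw [le_div_iff₀ hδ0]; nlinarith
    linarith [Real.exp_one_lt_d9]
  have hLδ : Real.exp (-L) = δ / N := by
    rw [Real.exp_neg, hL, Real.exp_log (by positivity), inv_div]
  set g : Fin N → Ω → EuclideanSpace ℝ (Fin m) := fun i ω => √(N : ℝ) • b i ω with hgdef
  have hg : ∀ i, HasLaw (g i) (stdGaussian (EuclideanSpace ℝ (Fin m))) P :=
    fun i => hasLaw_sqrt_smul hN0 (hb i)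
  have hgind : iIndepFun g P :=
    hbind.comp (fun _ x => √(N : ℝ) • x) fun _ => measurable_const_smul _
  have hd0 : 0 ≤ vecNorm ∞ v := vecNorm_nonneg _ v
  obtain ⟨Bad, hBad, hgood⟩ := exists_bad_event hN hd0 (abs_le_vecNorm_top v) hg hgind hδ0 hδ1
    (by linarith : 0 < L) hLδ
  suffices hsub : Badᶜ ⊆ {ω | ‖fourthMomentMatrix (fun i => plantedRow (v i) (b i ω))
      - (vecNorm 4 v ^ 4 - 3 / (N : ℝ)) • firstProj m‖ ≤ etaBound 1000000000 N (m + 1) v δ} by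
    rw [ENNReal.ofReal_sub _ hδ0.le, ENNReal.ofReal_one]
    refine le_trans ?_ (measure_mono hsub)
    rw [tsub_le_iff_right]
    calc (1 : ℝ≥0∞) = P Set.univ := measure_univ.symm
      _ ≤ P (Badᶜ ∪ Bad) := by rw [Set.compl_union_self]
      _ ≤ P Badᶜ + P Bad := measure_union_le _ _
      _ ≤ _ := by gcongr
  intro ω hω
  obtain ⟨hT, hA, hB, hC1, hC2, hD, hE⟩ := hgood ω hω
  have htr : ∀ i, truncDev (truncLevel m L) (g i ω) = normSqDev (g i ω) :=
    fun i => truncDev_eq (hT i)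
  -- Off the exceptional event the truncation is inactive, so the bounds hold for the original
  -- deviations.
  simp only [htr] at hC1 hC2 hE
  have hK0 := truncLevel_nonneg (m := m) (show 0 ≤ L by linarith)
  set c1 := 2 * (2 * (√(100000 * (2000000 * (m + 1))) * √(∑ i, v i ^ 2) * √(4 * (m + L))
          + 16 * truncLevel m L * vecNorm ∞ v * (4 * (m + L)))) with hc1
  set c2 := 2 * (2 * (√(truncLevel m L ^ 2) * √(∑ i, v i ^ 2) * √(4 * (m + L))
          + 0 * vecNorm ∞ v * (4 * (m + L)))) with hc2
  have hC : ∀ x, |weightedSum (fun i => v i * normSqDev (g i ω)) (fun i => g i ω) x|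
      ≤ min c1 c2 * ‖x‖ := fun x => by
    rcases min_choice c1 c2 with h | h <;> rw [h]
    · exact hC1 x
    · exact hC2 x
  have hnorm := norm_fourthMomentMatrix_sub_le hN0 v (fun i => b i ω) (fun i => g i ω)
    (fun i => rfl) hA (by positivity) hB (le_min (by positivity) (by positivity)) hC
    (by positivity) hD (by positivity) hE
  refine hnorm.trans ?_
  have hss : √(N : ℝ) ^ 2 = N := Real.sq_sqrt hN0'.le
  have hll : √L ^ 2 = L := Real.sq_sqrt (by linarith)
  have hrr : √(m + 1 : ℝ) ^ 2 = m + 1 := Real.sq_sqrt (by positivity)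
  have hl1 : 1 ≤ √L := Real.one_le_sqrt.2 hL1
  have hr1 : 1 ≤ √(m + 1 : ℝ) := Real.one_le_sqrt.2 (by simp)
  -- L ≥ 1 lowers the exponent 7 to 3, the form needed in the comparison of error terms.
  have hls : √L ^ 3 ≤ √(N : ℝ) := by
    refine Real.le_sqrt_of_sq_le ?_
    calc (√L ^ 3) ^ 2 = (√L ^ 2) ^ 3 := by ring
      _ = L ^ 3 := by rw [hll]
      _ ≤ L ^ 7 := pow_le_pow_right₀ hL1 (by norm_num)
      _ ≤ N := hLN
  have h4L : √(4 * L) = 2 * √L := by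
    rw [Real.sqrt_mul (by norm_num), show (4 : ℝ) = 2 ^ 2 by norm_num, Real.sqrt_sq (by norm_num)]
  have hsq : ∀ {c k : ℝ}, 0 ≤ c → 0 ≤ k → c ≤ k ^ 2 → √(c * (m + 1)) ≤ k * √(m + 1 : ℝ) := by
    intro c k hc hk h
    rw [Real.sqrt_mul hc]
    gcongr
    exact Real.sqrt_le_left hk |>.2 h
  have hs1 : √(100000 * (m + 1 : ℝ)) ≤ 400 * √(m + 1 : ℝ) :=
    hsq (by norm_num) (by norm_num) (by norm_num)
  have hs2 : √(100000 * (2000000 * (m + 1 : ℝ))) ≤ 500000 * √(m + 1 : ℝ) := by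
    rw [← mul_assoc]; exact hsq (by norm_num) (by norm_num) (by norm_num)
  have hs3 : √(2000000 * (m + 1 : ℝ)) ≤ 2000 * √(m + 1 : ℝ) :=
    hsq (by norm_num) (by norm_num) (by norm_num)
  have hs4 : √(100000 : ℝ) ≤ 400 := Real.sqrt_le_left (by norm_num) |>.2 (by norm_num)
  have hK : truncLevel m L ≤ 1600 * (√(m + 1 : ℝ) * √L + √L ^ 2) := by
    rw [truncLevel, h4L, hll]
    calc _ ≤ 2 * (400 * √(m + 1 : ℝ) * (2 * √L) + 16 * (4 * L)) := by gcongr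
      _ ≤ _ := by linarith
  have hTle : 4 * (m + L) ≤ 4 * (√(m + 1 : ℝ) ^ 2 + √L ^ 2) := by rw [hll, hrr]; linarith
  have htle : √(4 * (m + L)) ≤ 2 * (√(m + 1 : ℝ) + √L) := by
    refine Real.sqrt_le_left (by positivity) |>.2 (hTle.trans ?_)
    have : 0 ≤ √(m + 1 : ℝ) * √L := by positivity
    nlinarith
  have e2 := sqrt_sum_sq_eq_vecNorm_two v
  have e4 := sqrt_sum_sq_sq_eq_vecNorm_four_sq v
  have e6 := sqrt_sum_cube_sq_eq_vecNorm_six_cube v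
  rw [e2] at hc1 hc2
  rw [e4, e6, Real.sqrt_one]
  have : Fact ((1 : ℝ≥0∞) ≤ 6) := ⟨by norm_num⟩
  have ha := vecNorm_nonneg 2 v
  have h6 := vecNorm_nonneg 6 v
  have main := error_terms_le (A4 := vecNorm 4 v ^ 2) (A6 := vecNorm 6 v ^ 3)
    (tA := 2 * (√(100000 * (m + 1)) * vecNorm 4 v ^ 2 * √(4 * L)
      + 16 * vecNorm ∞ v ^ 2 * (4 * L)))
    (tB := 2 * (2 * (1 * vecNorm 6 v ^ 3 * √(4 * (m + L))
      + 0 * vecNorm ∞ v ^ 3 * (4 * (m + L)))))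
    (tC := min c1 c2)
    (tD := 4 * (2 * (√100000 * vecNorm 4 v ^ 2 * √(4 * (m + L))
      + 16 * vecNorm ∞ v ^ 2 * (4 * (m + L)))))
    (tE := 4 * (2 * (√(100000 * (2000000 * (m + 1))) * √(N : ℝ) * √(4 * (m + L))
          + 16 * truncLevel m L * 1 * (4 * (m + L)))
          + N * (50001 * √(2000000 * (m + 1)) / √N)))
    hr1 hl1 hls (Real.sqrt_nonneg (4 * (m + L))) (by positivity) ha (by positivity)
    (by positivity) hd0 hK hTle htle
    (by
      rw [h4L, hll]
      calc _ ≤ 2 * (400 * √(m + 1 : ℝ) * vecNorm 4 v ^ 2 * (2 * √L)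
            + 16 * vecNorm ∞ v ^ 2 * (4 * L)) := by gcongr
        _ = _ := by ring)
    (le_of_eq (by ring))
    (by
      refine (min_le_left _ _).trans ?_
      rw [hc1]
      calc _ ≤ 2 * (2 * (500000 * √(m + 1 : ℝ) * vecNorm 2 v * √(4 * (m + L))
            + 16 * truncLevel m L * vecNorm ∞ v * (4 * (m + L)))) := by gcongr
        _ = _ := by ring)
    (by
      refine (min_le_right _ _).trans ?_
      rw [hc2, Real.sqrt_sq hK0]
      exact le_of_eq (by ring))
    (by
      calc _ ≤ 4 * (2 * (400 * vecNorm 4 v ^ 2 * √(4 * (m + L))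
            + 16 * vecNorm ∞ v ^ 2 * (4 * (m + L)))) := by gcongr
        _ = _ := by ring)
    (by
      have h1 : N * (50001 * √(2000000 * (m + 1 : ℝ)) / √(N : ℝ))
          ≤ √(N : ℝ) * (50001 * (2000 * √(m + 1 : ℝ))) := by
        nth_rewrite 1 [← hss]
        have : 0 < √(N : ℝ) := Real.sqrt_pos.2 hN0'
        calc √(N : ℝ) ^ 2 * (50001 * √(2000000 * (m + 1 : ℝ)) / √(N : ℝ))
            = √(N : ℝ) * (50001 * √(2000000 * (m + 1 : ℝ))) := by field_simp
          _ ≤ _ := by gcongr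
      rw [mul_one]
      gcongr)
  rw [hss] at main
  rw [etaBound, ← hL]
  have hNs : (N : ℝ) ^ (3 / 2 : ℝ) = √(N : ℝ) ^ 3 := by
    rw [Real.sqrt_eq_rpow, ← Real.rpow_natCast, ← Real.rpow_mul hN0'.le]; norm_num
  have hnL : √(((m + 1 : ℕ) : ℝ) * L) = √(m + 1 : ℝ) * √L := by
    push_cast; exact Real.sqrt_mul (by positivity) _
  have hnL3 : (((m + 1 : ℕ) : ℝ) * L) ^ (3 / 2 : ℝ) = (√(m + 1 : ℝ) * √L) ^ 3 := by
    rw [← hnL, Real.sqrt_eq_rpow, ← Real.rpow_natCast, ← Real.rpow_mul (by positivity)]; norm_num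
  have hs4' : √(N : ℝ) ^ 4 = (N : ℝ) ^ 2 := by rw [show √(N : ℝ) ^ 4 = (√(N : ℝ) ^ 2) ^ 2 by ring, hss]
  have hl4 : √L ^ 4 = L ^ 2 := by
    calc √L ^ 4 = (√L ^ 2) ^ 2 := by ring
      _ = _ := by rw [hll]
  rw [hNs, hnL, hnL3]
  rw [hrr, hll, hl4, hs4'] at main
  push_cast
  have hlast : 0 ≤ |vecNorm 2 v ^ 2 - 1| / (N : ℝ) := by positivity
  have hlast2 : 1 / (N : ℝ) * |vecNorm 2 v ^ 2 - 1| = |vecNorm 2 v ^ 2 - 1| / N := by ring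
  rw [hlast2]
  linarith
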